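/- A function $f:\{0,1\}^d\to\mathbb{R}$ is unate if for every coordinate $i\in[d]$ it is either nondecreasing in the $i$-th coordinate or nonincreasing in the $i$-th coordinate; it is $\varepsilon$-far from unate if every unate function $g:\{0,1\}^d\to\mathbb{R}$ differs from $f$ on at least $\varepsilon 2^d$ points. A nonadaptive unateness tester with distance parameter $\varepsilon$ is a randomized algorithm that chooses the set of all points it queries before seeing any value of $f$, then decides on the basis of its randomness and the values of $f$ at these points, and that accepts with probability at least $2/3$ if $f$ is unate and rejects with probability at least $2/3$ if $f$ is $\varepsilon$-far from unate (so errors on both sides are allowed). Theorem. Any nonadaptive unateness tester, even with two-sided error, for functions $f:\{0,1\}^d\to\mathbb{R}$ with distance parameter $\varepsilon=1/8$ must make $\Omega(d\log d)$ queries. That is, there are absolute constants $c>0$ and $d_0$ such that for every $d\ge d_0$, if such a tester makes at most $q$ queries (with probability one over its randomness), then $q\ge c\,d\log d$. -/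

import Mathlib

open MeasureTheory

/-- The hypercube `{0,1}^d`. -/
abbrev Cube (d : ℕ) : Type := Fin d → Bool

/-- A real-valued function on the hypercube is unate if in every coordinate it is nondecreasing,
or in that coordinate it is nonincreasing (the direction may depend on the coordinate only). -/
def IsUnate {d : ℕ} (f : Cube d → ℝ) : Prop :=
  ∀ i : Fin d,
    (∀ x : Cube d, Monotone fun a : Bool => f (Function.update x i a)) ∨
    (∀ x : Cube d, Antitone fun a : Bool => f (Function.update x i a))

/-- `f` is `ε`-far from unate: to turn `f` into a unate function `g`, at least an `ε` fraction of
the `2 ^ d` values has to be modified. -/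
def IsFarFromUnate {d : ℕ} (ε : ℝ) (f : Cube d → ℝ) : Prop :=
  ∀ g : Cube d → ℝ, IsUnate g →
    ε * (2 : ℝ) ^ d ≤ ((Finset.univ.filter fun x : Cube d => f x ≠ g x).card : ℝ)

/-- A randomized nonadaptive algorithm with query access to a function `Cube d → ℝ`. The random
seed `ω` is drawn from a probability space. It determines the whole set of queried points, before
any answer is seen; the verdict (`true` = accept) is an arbitrary function of the seed and of the
values of the input function at the queried points. -/
structure NonadaptiveAlgorithm (d : ℕ) (Ω : Type*) [MeasurableSpace Ω] where
  /-- the law of the random seed -/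
  μ : Measure Ω
  isProbabilityMeasure : IsProbabilityMeasure μ
  /-- the set of points queried on a given seed -/
  queries : Ω → Finset (Cube d)
  /-- the verdict, given the seed and the answers to the queries -/
  verdict : (ω : Ω) → ({x : Cube d // x ∈ queries ω} → ℝ) → Bool
  measurableSet_queries : ∀ Q : Finset (Cube d), MeasurableSet {ω | queries ω = Q}
  measurableSet_verdict : ∀ f : Cube d → ℝ,
    MeasurableSet {ω | verdict ω (fun x => f x.1) = true}

namespace NonadaptiveAlgorithm

variable {d : ℕ} {Ω : Type*} [MeasurableSpace Ω]

/-- The probability that the algorithm accepts the input function `f`. -/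
noncomputable def acceptProb (T : NonadaptiveAlgorithm d Ω) (f : Cube d → ℝ) : ℝ :=
  T.μ.real {ω | T.verdict ω (fun x => f x.1) = true}

/-- The probability that the algorithm rejects the input function `f`. -/
noncomputable def rejectProb (T : NonadaptiveAlgorithm d Ω) (f : Cube d → ℝ) : ℝ :=
  T.μ.real {ω | T.verdict ω (fun x => f x.1) = false}

/-- The algorithm is a (two-sided error) unateness tester with distance parameter `ε`. -/
def IsUnatenessTester (T : NonadaptiveAlgorithm d Ω) (ε : ℝ) : Prop :=
  (∀ f : Cube d → ℝ, IsUnate f → 2 / 3 ≤ T.acceptProb f) ∧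
  (∀ f : Cube d → ℝ, IsFarFromUnate ε f → 2 / 3 ≤ T.rejectProb f)

/-- With probability one, the algorithm makes at most `q` queries. -/
def MakesAtMost (T : NonadaptiveAlgorithm d Ω) (q : ℕ) : Prop :=
  ∀ᵐ ω ∂T.μ, (T.queries ω).card ≤ q

end NonadaptiveAlgorithm

/-!
Why the lower bound holds.

*Only the order of the answers matters.* Let `𝒰` be a nonprincipal ultrafilter on `ℕ`. Instead of a
function `f` with values in `{0, …, N - 1}`, feed the tester the functions `v ∘ f`, where
`v 0 < v 1 < ⋯` is generic: take the limit of the acceptance probability as `v (N - 1)`, then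
`v (N - 2)`, …, then `v 0` tends along `𝒰`. For a fixed query set `Q` the value of the iterated
limit does not notice the variables that no query sees, so it depends on `f` only through the order
pattern of `f` on `Q` (`exists_orderInvariant_limit`). This takes the place of a Ramsey argument.

*The hard functions.* Write `d = n + s` with `2 ^ s ≤ d < 2 ^ (s + 1)`. The last `s` coordinates cut
the cube into `2 ^ s` subcubes. Fix a scale `M = 2 ^ k`; throw `M` labels at random coordinates
`h u` among the first `n`, and give each subcube a random label `t i`, hence a pivot `r i = h (t i)`.
On subcube `i` the function `hardFn` ignores the coordinates in the range of `h`, except for the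
pivot, in which it increases or decreases according to a sign. If the signs are `α (r i)`, the
function is unate. If the signs `β i` are independent, then for every choice of directions about
half of the subcubes disagree, up to a deviation controlled by a second moment
(`prob_exists_few_disagreements_le`), and the function is `1/8`-far from unate
(`isFarFromUnate_comp_hardFn`).

*Indistinguishability.* The order of the values at two points of a subcube can depend on its sign
only if the pivot is the largest coordinate in which they differ, apart from coordinates in the
range of `h`. As that range is sparse, with high probability for all pairs of queries at most one
coordinate is skipped in this way, and then the pivot is among the two largest differing
coordinates: it is *captured*. If no two subcubes with the same pivot both have it captured, the
visible signs are independent fair bits for both distributions (`expect_eq_of_not_isRevealing`).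

*Where the logarithm comes from.* A set `P` of points captures at most `2 * |P|` coordinates: there
are linearly independent differences of points of `P` that account for all of them
(`card_captured_le`). So, if `N a` is the number of subcubes in which `a` is captured, then
`∑ a, N a ≤ 2 * |Q|`, and at scale `M` a collision has probability at most
`∑ a, (M / n) * min 1 ((N a) ^ 2 / M ^ 2)`. Summed over all scales `M = 2 ^ k`, the contribution of
`a` is a two-sided geometric series of size `O(N a / n)` (`sum_two_pow_mul_min_le`), so the
collision probability is on average `O(|Q| / (n * K))` over `K = ⌊s / 4⌋` scales. A tester has to
succeed at every scale, which forces `|Q| = Ω(d log d)`.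
-/

/-! ### Generic increasing values: order-invariant limits -/

section OrderInvariance

open Filter Topology

/-- The ultrafilter of generic increasing lists of length `N`: the `N`-fold iterated product of a
nonprincipal ultrafilter on `ℕ`. A limit along it is an iterated limit, in which the last entry goes
to infinity first. -/
noncomputable def genericList : ℕ → Ultrafilter (List ℕ)
  | 0 => pure []
  | N + 1 => (hyperfilter ℕ).bind fun a => (genericList N).map (List.cons a)

/-- The sublist of the entries at the positions marked `true`. (The value on lists of different
lengths is irrelevant.) -/
def keep : List Bool → List ℕ → List ℕ
  | true :: bs, a :: l => a :: keep bs l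
  | false :: bs, _ :: l => keep bs l
  | _, _ => []

theorem Ultrafilter.map_bind' {α β γ : Type} (f : Ultrafilter α) (m : α → Ultrafilter β)
    (g : β → γ) : (f.bind m).map g = f.bind fun a => (m a).map g :=
  Ultrafilter.coe_injective (Filter.map_bind g (f : Filter α) fun a => (m a : Filter β))

theorem Ultrafilter.bind_const' {α β : Type} (f : Ultrafilter α) (u : Ultrafilter β) :
    (f.bind fun _ => u) = u := by
  ext s
  change s ∈ Filter.bind (f : Filter α) (fun _ => (u : Filter β)) ↔ _
  rw [Filter.mem_bind']
  by_cases h : s ∈ (u : Filter β)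
  · exact iff_of_true (by simp [h]) h
  · exact iff_of_false (by simp [h]) h

/-- Restricting a generic list to a fixed set of positions gives a generic list of the shorter
length, whatever the positions are. -/
theorem map_keep_genericList (bs : List Bool) :
    (genericList bs.length).map (keep bs) = genericList (bs.count true) := by
  induction bs with
  | nil => simp only [List.length_nil, List.count_nil, genericList]; rfl
  | cons b bs ih =>
    rw [List.length_cons, genericList, Ultrafilter.map_bind']
    simp only [Ultrafilter.map_map]
    cases b
    · have : ∀ a : ℕ, (keep (false :: bs) ∘ List.cons a) = keep bs := fun a => by
        funext l; simp [keep]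
      simp only [this, ih, Ultrafilter.bind_const']
      simp
    · have : ∀ a : ℕ, (keep (true :: bs) ∘ List.cons a) = List.cons a ∘ keep bs := fun a => by
        funext l; simp [keep]
      simp only [this, ← Ultrafilter.map_map, ih]
      simp [genericList]

theorem eventually_genericList (N c : ℕ) :
    ∀ᶠ l in (genericList N : Filter (List ℕ)),
      l.length = N ∧ l.Pairwise (· < ·) ∧ ∀ x ∈ l, c < x := by
  induction N generalizing c with
  | zero => 
    change ∀ᶠ l in (pure [] : Filter (List ℕ)), _
    simp
  | succ N ih =>
    change ∀ᶠ l in Filter.bind (hyperfilter ℕ : Filter ℕ)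
      (fun a => Filter.map (List.cons a) (genericList N : Filter (List ℕ))), _
    rw [Filter.eventually_bind]
    have h1 : ∀ᶠ a in (hyperfilter ℕ : Filter ℕ), c < a :=
      Nat.hyperfilter_le_atTop (eventually_gt_atTop c)
    filter_upwards [h1] with a ha
    rw [Filter.eventually_map]
    filter_upwards [ih a] with l hl
    refine ⟨by simp [hl.1], List.pairwise_cons.2 ⟨hl.2.2, hl.2.1⟩, ?_⟩
    intro x hx
    rcases List.mem_cons.1 hx with rfl | hx
    · exact ha
    · exact ha.trans (hl.2.2 x hx)

theorem getD_keep (bs : List Bool) (l : List ℕ) (i : ℕ) (hl : l.length = bs.length)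
    (hi : bs[i]? = some true) :
    (keep bs l).getD ((bs.take i).count true) 0 = l.getD i 0 := by
  induction bs generalizing l i with
  | nil => simp at hi
  | cons b bs ih =>
    cases l with
    | nil => simp at hl
    | cons a l =>
      cases i with
      | zero =>
        simp at hi
        subst hi
        simp [keep]
      | succ i =>
        have := ih l i (by simpa using hl) (by simpa using hi)
        cases b <;> simpa [keep] using this

/-- The list of truth values of `p` at `0, …, N - 1`. -/
def rankMask (p : ℕ → Prop) [DecidablePred p] (N : ℕ) : List Bool :=
  (List.range N).map fun r => decide (p r)

theorem count_rankMask (p : ℕ → Prop) [DecidablePred p] (N : ℕ) :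
    (rankMask p N).count true = Nat.count p N := by
  simp [rankMask, Nat.count, List.count, List.countP_map, Function.comp_def]

theorem take_rankMask (p : ℕ → Prop) [DecidablePred p] {i N : ℕ} (h : i ≤ N) :
    (rankMask p N).take i = rankMask p i := by
  simp [rankMask, ← List.map_take, List.take_range, h]

theorem exists_tendsto_of_mem_Icc {α : Type*} (U : Ultrafilter α) (F : α → ℝ) {B : ℝ}
    (hF : ∀ a, F a ∈ Set.Icc 0 B) : ∃ L ∈ Set.Icc 0 B, Tendsto F U (𝓝 L) := by
  obtain ⟨L, hL, h⟩ := (isCompact_Icc (a := (0 : ℝ)) (b := B)).ultrafilter_le_nhds (U.map F) (by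
    rw [le_principal_iff, Ultrafilter.coe_map, Filter.mem_map]
    exact Filter.univ_mem' hF)
  exact ⟨L, hL, h⟩

/-- Functions with the same order pattern on `Q` give every point the same position among the
values taken on `Q`. -/
theorem count_image_eq {X : Type*} [DecidableEq X] {Q : Finset X} {f g : X → ℕ}
    (h : ∀ x ∈ Q, ∀ y ∈ Q, f x < f y ↔ g x < g y) {i j : ℕ}
    (hij : ∀ x ∈ Q, f x < i ↔ g x < j) :
    Nat.count (· ∈ Q.image f) i = Nat.count (· ∈ Q.image g) j := by
  rw [Nat.count_eq_card_filter_range, Nat.count_eq_card_filter_range]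
  have key : ∀ x ∈ Q, ∀ y ∈ Q, f x = f y ↔ g x = g y := fun x hx y hy => by
    have := h x hx y hy
    have := h y hy x hx
    omega
  have hf : ∀ (f : X → ℕ) (i : ℕ), {a ∈ Finset.range i | a ∈ Q.image f}
      = (Q.filter (f · < i)).image f := by
    intro f i; ext a
    simp only [Finset.mem_filter, Finset.mem_range, Finset.mem_image]
    constructor
    · rintro ⟨h1, x, hx, rfl⟩; exact ⟨x, ⟨hx, h1⟩, rfl⟩
    · rintro ⟨x, ⟨hx, h1⟩, rfl⟩; exact ⟨h1, x, hx, rfl⟩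
  rw [hf, hf, Finset.filter_congr hij]
  set S := Q.filter (g · < j)
  have hS : ∀ x ∈ S, x ∈ Q := fun x hx => (Finset.mem_filter.1 hx).1
  have h1 : S.image f = (S.image fun x => (f x, g x)).image Prod.fst := by
    rw [Finset.image_image]; rfl
  have h2 : S.image g = (S.image fun x => (f x, g x)).image Prod.snd := by
    rw [Finset.image_image]; rfl
  rw [h1, h2]
  refine (Finset.card_image_of_injOn ?_).trans (Finset.card_image_of_injOn ?_).symm
  all_goals
    intro a ha b hb hab
    obtain ⟨x, hx, rfl⟩ := Finset.mem_image.1 ha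
    obtain ⟨y, hy, rfl⟩ := Finset.mem_image.1 hb
  · exact Prod.ext hab ((key x (hS x hx) y (hS y hy)).1 hab)
  · exact Prod.ext ((key x (hS x hx) y (hS y hy)).2 hab) hab

/-- If `F` looks at a function on `Q` only, its limit along generic values is a limit over values
for the ranks that `f` takes on `Q`; the rank `f x` is replaced by its position among them. -/
theorem tendsto_genericList_of_tendsto_positions {X : Type*} [DecidableEq X] {N : ℕ} {Q : Finset X}
    {F : (X → ℝ) → ℝ} (hloc : ∀ f g : X → ℝ, (∀ x ∈ Q, f x = g x) → F f = F g)
    {f : X → ℕ} (hf : ∀ x ∈ Q, f x < N) {L : ℝ}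
    (hL : Tendsto (fun w : List ℕ => F fun x => ((w.getD (Nat.count (· ∈ Q.image f) (f x)) 0 : ℕ) : ℝ))
      (genericList (Nat.count (· ∈ Q.image f) N)) (𝓝 L)) :
    Tendsto (fun l : List ℕ => F fun x => ((l.getD (f x) 0 : ℕ) : ℝ)) (genericList N) (𝓝 L) := by
  have h := map_keep_genericList (rankMask (· ∈ Q.image f) N)
  have hlen : (rankMask (· ∈ Q.image f) N).length = N := by simp [rankMask]
  rw [hlen, count_rankMask] at h
  rw [← h, Ultrafilter.coe_map, tendsto_map'_iff] at hL
  refine hL.congr' ?_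
  filter_upwards [eventually_genericList N 0] with l hl
  refine hloc _ _ fun x hx => ?_
  have := getD_keep (rankMask (· ∈ Q.image f) N) l (f x) (by rw [hlen, hl.1])
    (by simp only [rankMask, List.getElem?_map, List.getElem?_range (hf x hx)]
        simpa using ⟨x, hx, rfl⟩)
  rw [take_rankMask _ (hf x hx).le, count_rankMask] at this
  rw [this]

/-- A family of functionals `F Q`, each of which depends only on the values on `Q`, has a limit
along generic increasing values that depends only on the order pattern on `Q`. A closed condition on
`∑ Q, F Q (v ∘ f)` that holds for all increasing `v` passes to the limit. -/
theorem exists_orderInvariant_limit {X : Type*} [Fintype X] [DecidableEq X] (N : ℕ)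
    (F : Finset X → (X → ℝ) → ℝ) (B : Finset X → ℝ) (hF : ∀ Q f, F Q f ∈ Set.Icc 0 (B Q))
    (hloc : ∀ Q, ∀ f g : X → ℝ, (∀ x ∈ Q, f x = g x) → F Q f = F Q g) :
    ∃ H : Finset X → (X → ℕ) → ℝ, (∀ Q f, H Q f ∈ Set.Icc 0 (B Q)) ∧
      (∀ Q f g, (∀ x ∈ Q, f x < N) → (∀ x ∈ Q, g x < N) →
        (∀ x ∈ Q, ∀ y ∈ Q, f x < f y ↔ g x < g y) → H Q f = H Q g) ∧
      ∀ f : X → ℕ, (∀ x, f x < N) → ∀ C : Set ℝ, IsClosed C →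
        (∀ v : ℕ → ℝ, StrictMonoOn v (Set.Iio N) → ∑ Q, F Q (v ∘ f) ∈ C) →
        ∑ Q, H Q f ∈ C := by
  choose H hH hT using fun Q (f : X → ℕ) => exists_tendsto_of_mem_Icc (genericList N)
    (fun l => F Q fun x => ((l.getD (f x) 0 : ℕ) : ℝ)) (fun l => hF Q _)
  refine ⟨H, hH, ?_, ?_⟩
  · intro Q f g hf hg hfg
    obtain ⟨L, -, hL⟩ := exists_tendsto_of_mem_Icc (genericList (Nat.count (· ∈ Q.image f) N))
      (fun w => F Q fun x => ((w.getD (Nat.count (· ∈ Q.image f) (f x)) 0 : ℕ) : ℝ))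
      (fun l => hF Q _)
    have e1 := tendsto_genericList_of_tendsto_positions (hloc Q) hf hL
    have hN : Nat.count (· ∈ Q.image f) N = Nat.count (· ∈ Q.image g) N :=
      count_image_eq hfg fun x hx => iff_of_true (hf x hx) (hg x hx)
    have e2 := tendsto_genericList_of_tendsto_positions (hloc Q) hg (L := L) (by
      rw [← hN]
      refine hL.congr fun w => hloc Q _ _ fun x hx => ?_
      rw [count_image_eq hfg fun y hy => hfg y hy x hx])
    rw [tendsto_nhds_unique (hT Q f) e1, tendsto_nhds_unique (hT Q g) e2]
  · intro f hf C hC h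
    refine hC.mem_of_tendsto (tendsto_finsetSum _ fun Q _ => hT Q f) ?_
    filter_upwards [eventually_genericList N 0] with l hl
    refine h (fun k => ((l.getD k 0 : ℕ) : ℝ)) ?_
    intro i hi j hj hij
    simp only [Set.mem_Iio] at hi hj
    rw [← hl.1] at hi hj
    simp only [List.getD_eq_getElem _ _ hi, List.getD_eq_getElem _ _ hj, Nat.cast_lt]
    exact List.pairwise_iff_getElem.1 hl.2.1 i j hi hj hij

end OrderInvariance

/-! ### Captured coordinates -/

/-- The `c` largest elements of `D` (all of `D` if there are fewer). -/
def topPart {α : Type*} [LinearOrder α] (c : ℕ) (D : Finset α) : Finset α :=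
  D.filter fun a => (D.filter (a < ·)).card < c

theorem topPart_subset {α : Type*} [LinearOrder α] (c : ℕ) (D : Finset α) : topPart c D ⊆ D :=
  Finset.filter_subset _ _

theorem mem_topPart_of_le {α : Type*} [LinearOrder α] {c : ℕ} {D : Finset α} {a b : α}
    (ha : a ∈ topPart c D) (hb : b ∈ D) (hab : a ≤ b) : b ∈ topPart c D := by
  simp only [topPart, Finset.mem_filter] at ha ⊢
  exact ⟨hb, (Finset.card_le_card
    (Finset.monotone_filter_right D fun x hx h => hab.trans_lt h)).trans_lt ha.2⟩

theorem injOn_card_filter_lt {α : Type*} [LinearOrder α] (D : Finset α) :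
    Set.InjOn (fun a => (D.filter (a < ·)).card) D := by
  have key : ∀ a ∈ D, ∀ b ∈ D, a < b → (D.filter (b < ·)).card < (D.filter (a < ·)).card := by
    intro a _ b hb hab
    refine Finset.card_lt_card (Finset.ssubset_iff_subset_ne.2
      ⟨Finset.monotone_filter_right D fun x _ h => hab.trans h, fun h => ?_⟩)
    have : b ∈ D.filter (b < ·) := h ▸ Finset.mem_filter.2 ⟨hb, hab⟩
    exact absurd (Finset.mem_filter.1 this).2 (lt_irrefl b)
  intro a ha b hb hab
  rcases lt_trichotomy a b with h | h | h
  · exact absurd hab (key a ha b hb h).ne'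
  · exact h
  · exact absurd hab (key b hb a ha h).ne

theorem image_card_filter_lt {α : Type*} [LinearOrder α] (D : Finset α) :
    D.image (fun a => (D.filter (a < ·)).card) = Finset.range D.card := by
  refine Finset.eq_of_subset_of_card_le ?_ ?_
  · intro k hk
    obtain ⟨a, ha, rfl⟩ := Finset.mem_image.1 hk
    refine Finset.mem_range.2 (Finset.card_lt_card (Finset.filter_ssubset.2 ⟨a, ha, lt_irrefl a⟩))
  · rw [Finset.card_image_of_injOn (injOn_card_filter_lt D), Finset.card_range]

theorem card_topPart {α : Type*} [LinearOrder α] (c : ℕ) (D : Finset α) :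
    (topPart c D).card = min c D.card := by
  rw [← Finset.card_image_of_injOn ((injOn_card_filter_lt D).mono (topPart_subset c D)),
    ← Finset.card_range (min c D.card)]
  congr 1
  ext k
  have := Finset.ext_iff.1 (image_card_filter_lt D) k
  simp only [Finset.mem_image, Finset.mem_range, topPart, Finset.mem_filter, lt_min_iff] at this ⊢
  rw [← this]
  constructor
  · rintro ⟨a, ⟨h1, h2⟩, rfl⟩; exact ⟨h2, a, h1, rfl⟩
  · rintro ⟨h2, a, h1, rfl⟩; exact ⟨a, ⟨h1, h2⟩, rfl⟩

/-- The set of coordinates on which two points of the cube differ. -/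
def diffSet {n : ℕ} (x y : Cube n) : Finset (Fin n) := Finset.univ.filter fun b => x b ≠ y b

/-- The coordinates that are among the `c` largest coordinates on which some two points of `P`
differ. -/
def captured {n : ℕ} (c : ℕ) (P : Finset (Cube n)) : Finset (Fin n) :=
  (P ×ˢ P).biUnion fun p => topPart c (diffSet p.1 p.2)

/-- A point of the cube as a `0`-`1` vector. -/
def realPoint {n : ℕ} (x : Cube n) : Fin n → ℝ := fun b => if x b then 1 else 0

theorem realPoint_sub_apply_eq_zero_iff {n : ℕ} (x y : Cube n) (b : Fin n) :
    (realPoint x - realPoint y) b = 0 ↔ b ∉ diffSet x y := by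
  simp only [realPoint, diffSet, Pi.sub_apply]
  cases hx : x b <;> cases hy : y b <;> simp [hx, hy]

/-- Going through the captured coordinates in increasing order, select a pair of points for each
coordinate that no earlier pair captures. Every earlier pair captures a smaller coordinate, and what
it captures is upward closed among its differing coordinates, so its points agree on the new
coordinate. Hence the differences of the selected pairs are linearly independent. -/
theorem exists_linearIndepOn_capturing {n : ℕ} (c : ℕ) (P : Finset (Cube n))
    (A : Finset (Fin n)) (hA : A ⊆ captured c P) :
    ∃ E ⊆ P ×ˢ P,
      LinearIndepOn ℝ (fun p : Cube n × Cube n => realPoint p.1 - realPoint p.2) ↑E ∧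
      (∀ p ∈ E, ∃ a ∈ A, a ∈ topPart c (diffSet p.1 p.2)) ∧
      A ⊆ E.biUnion fun p => topPart c (diffSet p.1 p.2) := by
  classical
  induction A using Finset.induction_on_max with
  | empty => exact ⟨∅, by simp, by simp, by simp, by simp⟩
  | insert a A ha ih =>
    obtain ⟨E, hEP, hlin, hcap, hAE⟩ := ih ((Finset.subset_insert a A).trans hA)
    by_cases haE : a ∈ E.biUnion fun p => topPart c (diffSet p.1 p.2)
    · exact ⟨E, hEP, hlin, fun p hp => (hcap p hp).imp fun b hb =>
        ⟨Finset.mem_insert_of_mem hb.1, hb.2⟩, Finset.insert_subset haE hAE⟩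
    · obtain ⟨p, hp, hap⟩ := Finset.mem_biUnion.1 (hA (Finset.mem_insert_self a A))
      refine ⟨insert p E, Finset.insert_subset hp hEP, ?_, ?_, ?_⟩
      · rw [Finset.coe_insert]
        refine hlin.insert fun hspan => ?_
        -- the pairs chosen before agree on coordinate `a`, the new pair does not
        have hle : Submodule.span ℝ
            ((fun p : Cube n × Cube n => realPoint p.1 - realPoint p.2) '' ↑E) ≤
            LinearMap.ker (LinearMap.proj (R := ℝ) (φ := fun _ : Fin n => ℝ) a) := by
          rw [Submodule.span_le]
          rintro _ ⟨e, he, rfl⟩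
          obtain ⟨b, hbA, hb⟩ := hcap e he
          refine (realPoint_sub_apply_eq_zero_iff e.1 e.2 a).2 fun had => haE ?_
          exact Finset.mem_biUnion.2 ⟨e, he, mem_topPart_of_le hb had (ha b hbA).le⟩
        exact (realPoint_sub_apply_eq_zero_iff p.1 p.2 a).1 (hle hspan) (topPart_subset c _ hap)
      · intro e he
        rcases Finset.mem_insert.1 he with rfl | he
        · exact ⟨a, Finset.mem_insert_self a A, hap⟩
        · exact (hcap e he).imp fun b hb => ⟨Finset.mem_insert_of_mem hb.1, hb.2⟩
      · rw [Finset.biUnion_insert]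
        refine Finset.insert_subset (Finset.mem_union_left _ hap) ?_
        exact hAE.trans Finset.subset_union_right

/-- A set of points captures at most `c` coordinates per point. -/
theorem card_captured_le {n : ℕ} (c : ℕ) (P : Finset (Cube n)) :
    (captured c P).card ≤ c * P.card := by
  classical
  obtain ⟨E, hEP, hlin, -, hcov⟩ := exists_linearIndepOn_capturing c P _ subset_rfl
  have h1 : E.card ≤ (P.image realPoint).card := by
    have := linearIndependent_le_span_aux' _ hlin (P.image realPoint : Finset _) (by
      rintro _ ⟨e, rfl⟩
      have he := Finset.mem_product.1 (hEP e.2)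
      exact sub_mem (Submodule.subset_span (by simpa using ⟨_, he.1, rfl⟩))
        (Submodule.subset_span (by simpa using ⟨_, he.2, rfl⟩)))
    simpa using this
  calc (captured c P).card ≤ (E.biUnion fun p => topPart c (diffSet p.1 p.2)).card :=
        Finset.card_le_card hcov
    _ ≤ E.card * c := Finset.card_biUnion_le_card_mul _ _ _ fun p _ => by
        rw [card_topPart]; exact min_le_left _ _
    _ ≤ P.card * c := Nat.mul_le_mul_right c (h1.trans Finset.card_image_le)
    _ = c * P.card := mul_comm _ _

/-! ### The hard functions -/

/-- The number whose binary digits are the coordinates of `u`, the last coordinate being the most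
significant one. -/
def binVal {d : ℕ} (u : Cube d) : ℕ :=
  ∑ k ∈ (Finset.univ.filter fun b => u b = true).image Fin.val, 2 ^ k

theorem binVal_lt_two_pow {d : ℕ} (u : Cube d) : binVal u < 2 ^ d := by
  refine Nat.geomSum_lt le_rfl fun k hk => ?_
  obtain ⟨b, -, rfl⟩ := Finset.mem_image.1 hk
  exact b.2

theorem binVal_mono {d : ℕ} {u v : Cube d} (h : ∀ b, u b = true → v b = true) :
    binVal u ≤ binVal v :=
  Finset.sum_le_sum_of_subset
    (Finset.image_subset_image (Finset.monotone_filter_right _ fun b _ => h b))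

/-- Comparison of binary numbers: the most significant differing digit decides. -/
theorem binVal_lt_iff {d : ℕ} {u v : Cube d} :
    binVal u < binVal v ↔ ∃ a, u a = false ∧ v a = true ∧ ∀ b, a < b → u b = v b := by
  rw [binVal, binVal]
  rw [Finset.geomSum_lt_geomSum_iff_toColex_lt_toColex le_rfl,
    Finset.Colex.toColex_image_lt_toColex_image Fin.val_strictMono,
    Finset.Colex.toColex_lt_toColex_iff_exists_forall_lt]
  simp only [Finset.mem_filter, Finset.mem_univ, true_and, Bool.not_eq_true]
  constructor
  · rintro ⟨a, hva, hua, hlt⟩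
    have hne : (diffSet u v).Nonempty := ⟨a, by simp [diffSet, hva, hua]⟩
    set c := (diffSet u v).max' hne with hc
    have hac : a ≤ c := Finset.le_max' _ _ (by simp [diffSet, hva, hua])
    have hcm : u c ≠ v c := by
      have := Finset.max'_mem _ hne
      rw [← hc] at this
      simpa [diffSet] using this
    have habove : ∀ b, c < b → u b = v b := fun b hb => by
      by_contra hbne
      exact absurd (Finset.le_max' (diffSet u v) b (by simpa [diffSet] using hbne)) (not_le.2 hb)
    cases huc : u c <;> cases hvc : v c <;> simp only [huc, hvc, ne_eq, not_true] at hcm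
    · exact ⟨c, huc, hvc, habove⟩
    · exact absurd (hlt c huc hvc) (not_lt.2 hac)
  · rintro ⟨a, hua, hva, h⟩
    refine ⟨a, hva, hua, fun b hub hvb => ?_⟩
    rcases lt_trichotomy a b with hab | rfl | hab
    · rw [h b hab, hvb] at hub; cases hub
    · rw [hua] at hub; cases hub
    · exact hab

section Hard

variable {n s : ℕ}

/-- The first `n` coordinates of a point: its position inside its subcube. -/
def low (x : Cube (n + s)) : Cube n := fun b => x (Fin.castAdd s b)

/-- The last `s` coordinates of a point: they name the subcube that contains it. -/
def high (x : Cube (n + s)) : Cube s := fun b => x (Fin.natAdd n b)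

theorem append_low_high (x : Cube (n + s)) : Fin.append (low x) (high x) = x :=
  Fin.append_castAdd_natAdd

@[simp] theorem low_append (y : Cube n) (i : Cube s) : low (Fin.append y i) = y := by
  funext b; simp [low]

@[simp] theorem high_append (y : Cube n) (i : Cube s) : high (Fin.append y i) = i := by
  funext b; simp [high]

@[simp] theorem low_update_castAdd (x : Cube (n + s)) (b : Fin n) (t : Bool) :
    low (Function.update x (Fin.castAdd s b) t) = Function.update (low x) b t := by
  funext c
  by_cases h : c = b
  · subst h; simp [low]
  · simp [low, h]

@[simp] theorem high_update_castAdd (x : Cube (n + s)) (b : Fin n) (t : Bool) :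
    high (Function.update x (Fin.castAdd s b) t) = high x := by
  funext c
  have : Fin.natAdd n c ≠ Fin.castAdd s b := by
    intro h; have := congrArg Fin.val h; simp at this; omega
  simp [high, this]

/-- The digits of the hard function inside one subcube with pivot coordinate `a` and sign `τ`: the
digit at `a` is the coordinate, negated if `τ = true`, the other coordinates in `R` are ignored,
and the remaining ones are kept. -/
def hardDigits (R : Finset (Fin n)) (a : Fin n) (τ : Bool) (y : Cube n) : Cube n :=
  fun b => if b = a then xor (y b) τ else if b ∈ R then false else y b

/-- The hard function: on the subcube named `i` it depends on the coordinates outside `R` and on the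
pivot coordinate `r i`, in which it increases if `σ i = false` and decreases if `σ i = true`. Its
value is the number with the digits `hardDigits`, preceded by the name of the subcube as the most
significant digits. -/
def hardFn (R : Finset (Fin n)) (r : Cube s → Fin n) (σ : Cube s → Bool) (x : Cube (n + s)) : ℕ :=
  binVal (Fin.append (hardDigits R (r (high x)) (σ (high x)) (low x)) (high x))

theorem hardFn_lt (R : Finset (Fin n)) (r : Cube s → Fin n) (σ : Cube s → Bool)
    (x : Cube (n + s)) : hardFn R r σ x < 2 ^ (n + s) := binVal_lt_two_pow _

theorem castAdd_lt_natAdd (b : Fin n) (c : Fin s) : Fin.castAdd s b < Fin.natAdd n c := by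
  rw [Fin.lt_def]; simp; omega

theorem binVal_append_lt_iff {y y' : Cube n} {i j : Cube s} :
    binVal (Fin.append y i) < binVal (Fin.append y' j) ↔
      binVal i < binVal j ∨ i = j ∧ binVal y < binVal y' := by
  simp only [binVal_lt_iff]
  constructor
  · rintro ⟨a, h1, h2, h3⟩
    induction a using Fin.addCases with
    | left a =>
      refine Or.inr ⟨?_, a, by simpa using h1, by simpa using h2, fun b hb => ?_⟩
      · funext c
        simpa using h3 (Fin.natAdd n c) (castAdd_lt_natAdd a c)
      · simpa using h3 (Fin.castAdd s b) hb
    | right a =>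
      refine Or.inl ⟨a, by simpa using h1, by simpa using h2, fun b hb => ?_⟩
      simpa using h3 (Fin.natAdd n b) (Nat.add_lt_add_left hb n)
  · rintro (⟨a, h1, h2, h3⟩ | ⟨rfl, a, h1, h2, h3⟩)
    · refine ⟨Fin.natAdd n a, by simpa using h1, by simpa using h2, fun b hb => ?_⟩
      induction b using Fin.addCases with
      | left b => exact absurd hb (castAdd_lt_natAdd b a).not_gt
      | right b => simpa using h3 b (Nat.lt_of_add_lt_add_left hb)
    · refine ⟨Fin.castAdd s a, by simpa using h1, by simpa using h2, fun b hb => ?_⟩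
      induction b using Fin.addCases with
      | left b => simpa using h3 b hb
      | right b => simp

theorem hardFn_lt_hardFn_iff {R : Finset (Fin n)} {r : Cube s → Fin n} {σ : Cube s → Bool}
    {x y : Cube (n + s)} :
    hardFn R r σ x < hardFn R r σ y ↔ binVal (high x) < binVal (high y) ∨ high x = high y ∧
      binVal (hardDigits R (r (high x)) (σ (high x)) (low x)) <
        binVal (hardDigits R (r (high y)) (σ (high y)) (low y)) :=
  binVal_append_lt_iff

/-- Changing the sign of the pivot `a` does not affect the order of the values at two points
unless `a` is among the two largest coordinates on which they differ. Hypothesis `h3` excludes that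
their three largest differing coordinates are all ignored or equal to the pivot. -/
theorem binVal_hardDigits_lt {R : Finset (Fin n)} {a : Fin n} (ha : a ∈ R) {τ τ' : Bool}
    {x y : Cube n} (h3 : 3 ≤ (diffSet x y).card → ¬ topPart 3 (diffSet x y) ⊆ R)
    (hτ : a ∈ topPart 2 (diffSet x y) → τ = τ')
    (h : binVal (hardDigits R a τ x) < binVal (hardDigits R a τ y)) :
    binVal (hardDigits R a τ' x) < binVal (hardDigits R a τ' y) := by
  rw [binVal_lt_iff] at h
  obtain ⟨c, hx, hy, habove⟩ := h
  by_cases hca : c = a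
  · subst hca
    -- every coordinate from `c` on in which `x` and `y` differ belongs to `R`
    have hR : ∀ b ∈ diffSet x y, c ≤ b → b ∈ R := by
      intro b hb hcb
      rcases hcb.eq_or_lt with rfl | hcb
      · exact ha
      · by_contra hbR
        have := habove b hcb
        simp only [hardDigits, hcb.ne', if_false, hbR] at this
        simp [diffSet, this] at hb
    have hcD : c ∈ diffSet x y := by
      simp only [hardDigits, if_true] at hx hy
      simp only [diffSet, Finset.mem_filter, Finset.mem_univ, true_and]
      intro hxy
      rw [hxy, hy] at hx
      cases hx
    have hc2 : c ∈ topPart 2 (diffSet x y) := by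
      by_contra hc2
      have hge : 2 ≤ ((diffSet x y).filter (c < ·)).card := by
        simpa [topPart, hcD, -Nat.not_lt, Nat.succ_le_iff] using hc2
      have hins : (insert c ((diffSet x y).filter (c < ·))).card
          = ((diffSet x y).filter (c < ·)).card + 1 :=
        Finset.card_insert_of_notMem (by simp)
      refine h3 ?_ fun b hb => ?_
      · have : insert c ((diffSet x y).filter (c < ·)) ⊆ diffSet x y :=
          Finset.insert_subset hcD (Finset.filter_subset _ _)
        have := Finset.card_le_card this
        omega
      · refine hR b (topPart_subset _ _ hb) (not_lt.1 fun hbc => ?_)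
        have hsub : insert c ((diffSet x y).filter (c < ·)) ⊆ (diffSet x y).filter (b < ·) := by
          refine Finset.insert_subset (Finset.mem_filter.2 ⟨hcD, hbc⟩) ?_
          exact Finset.monotone_filter_right _ fun z _ hz => hbc.trans hz
        have h4 := Finset.card_le_card hsub
        have h5 := (Finset.mem_filter.1 hb).2
        omega
    rw [← hτ hc2, binVal_lt_iff]
    exact ⟨c, hx, hy, habove⟩
  · rw [binVal_lt_iff]
    simp only [hardDigits, hca, if_false] at hx hy habove ⊢
    refine ⟨c, by simpa [hca] using hx, by simpa [hca] using hy, fun b hb => ?_⟩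
    have := habove b hb
    by_cases hba : b = a
    · simp only [hba, if_true] at this ⊢
      simpa using this
    · simpa [hba] using this

/-- The coordinates captured by the points of `Q` in the subcube named `i`, that is, those among the
two largest coordinates on which some two of these points differ. -/
def capturedIn (Q : Finset (Cube (n + s))) (i : Cube s) : Finset (Fin n) :=
  captured 2 ((Q.filter fun x => high x = i).image low)

theorem hardFn_lt_of_agree {Q : Finset (Cube (n + s))} {R : Finset (Fin n)} {r : Cube s → Fin n}
    (hr : ∀ i, r i ∈ R)
    (hQ : ∀ x ∈ Q, ∀ y ∈ Q, 3 ≤ (diffSet (low x) (low y)).card →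
      ¬ topPart 3 (diffSet (low x) (low y)) ⊆ R)
    {σ σ' : Cube s → Bool} (hσ : ∀ i, r i ∈ capturedIn Q i → σ i = σ' i)
    {x y : Cube (n + s)} (hx : x ∈ Q) (hy : y ∈ Q) (h : hardFn R r σ x < hardFn R r σ y) :
    hardFn R r σ' x < hardFn R r σ' y := by
  rw [hardFn_lt_hardFn_iff] at h ⊢
  refine h.imp_right fun h => ⟨h.1, ?_⟩
  have h2 := h.2
  rw [← h.1] at h2 ⊢
  refine binVal_hardDigits_lt (hr _) (hQ x hx y hy) (fun hc => hσ _ ?_) h2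
  refine Finset.mem_biUnion.2 ⟨(low x, low y), Finset.mem_product.2 ⟨?_, ?_⟩, hc⟩
  · exact Finset.mem_image_of_mem _ (Finset.mem_filter.2 ⟨hx, rfl⟩)
  · exact Finset.mem_image_of_mem _ (Finset.mem_filter.2 ⟨hy, h.1.symm⟩)

theorem hardFn_lt_iff_of_agree {Q : Finset (Cube (n + s))} {R : Finset (Fin n)}
    {r : Cube s → Fin n} (hr : ∀ i, r i ∈ R)
    (hQ : ∀ x ∈ Q, ∀ y ∈ Q, 3 ≤ (diffSet (low x) (low y)).card →
      ¬ topPart 3 (diffSet (low x) (low y)) ⊆ R)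
    {σ σ' : Cube s → Bool} (hσ : ∀ i, r i ∈ capturedIn Q i → σ i = σ' i)
    {x y : Cube (n + s)} (hx : x ∈ Q) (hy : y ∈ Q) :
    hardFn R r σ x < hardFn R r σ y ↔ hardFn R r σ' x < hardFn R r σ' y :=
  ⟨hardFn_lt_of_agree hr hQ hσ hx hy,
    hardFn_lt_of_agree hr hQ (fun i hi => (hσ i hi).symm) hx hy⟩

theorem sum_card_capturedIn_le (Q : Finset (Cube (n + s))) :
    ∑ i, (capturedIn Q i).card ≤ 2 * Q.card := by
  calc ∑ i, (capturedIn Q i).card ≤ ∑ i, 2 * (Q.filter fun x => high x = i).card :=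
        Finset.sum_le_sum fun i _ => (card_captured_le 2 _).trans
          (Nat.mul_le_mul_left 2 Finset.card_image_le)
    _ = 2 * Q.card := by
        rw [← Finset.mul_sum,
          Finset.card_eq_sum_card_fiberwise (f := high) (t := Finset.univ) (by simp)]

theorem monotone_bool_iff {φ : Bool → ℝ} : Monotone φ ↔ φ false ≤ φ true :=
  ⟨fun h => h (by decide), fun h a b hab => by
    cases a <;> cases b
    exacts [le_rfl, h, absurd hab (by decide), le_rfl]⟩

theorem antitone_bool_iff {φ : Bool → ℝ} : Antitone φ ↔ φ true ≤ φ false :=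
  ⟨fun h => h (by decide), fun h a b hab => by
    cases a <;> cases b
    exacts [le_rfl, h, absurd hab (by decide), le_rfl]⟩

theorem hardFn_update_castAdd (R : Finset (Fin n)) (r : Cube s → Fin n) (σ : Cube s → Bool)
    (x : Cube (n + s)) (b : Fin n) (t : Bool) :
    hardFn R r σ (Function.update x (Fin.castAdd s b) t) =
      binVal (Fin.append (hardDigits R (r (high x)) (σ (high x)) (Function.update (low x) b t))
        (high x)) := by
  simp [hardFn]

/-- If the sign of a subcube is a function of its pivot, the hard function is unate. -/
theorem isUnate_comp_hardFn {R : Finset (Fin n)} {r : Cube s → Fin n} (hr : ∀ i, r i ∈ R)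
    (α : Fin n → Bool) {v : ℕ → ℝ} (hv : StrictMonoOn v (Set.Iio (2 ^ (n + s)))) :
    IsUnate (v ∘ hardFn R r fun i => α (r i)) := by
  have hv' : ∀ x y, hardFn R r (fun i => α (r i)) x ≤ hardFn R r (fun i => α (r i)) y →
      v (hardFn R r (fun i => α (r i)) x) ≤ v (hardFn R r (fun i => α (r i)) y) :=
    fun x y h => hv.monotoneOn (hardFn_lt _ _ _ _) (hardFn_lt _ _ _ _) h
  intro c
  simp only [monotone_bool_iff, antitone_bool_iff, Function.comp_apply]
  induction c using Fin.addCases with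
  | left b =>
    by_cases hb : b ∈ R ∧ α b = true
    · refine Or.inr fun x => hv' _ _ ?_
      rw [hardFn_update_castAdd, hardFn_update_castAdd]
      refine binVal_mono fun c => ?_
      induction c using Fin.addCases with
      | left c =>
        simp only [Fin.append_left, hardDigits]
        by_cases hcb : c = b
        · subst hcb
          by_cases hca : c = r (high x)
          · simp [hb.2, ← hca]
          · simp [hca, hb.1]
        · simp [hcb]
      | right c => simp
    · refine Or.inl fun x => hv' _ _ ?_
      rw [hardFn_update_castAdd, hardFn_update_castAdd]
      refine binVal_mono fun c => ?_
      induction c using Fin.addCases with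
      | left c =>
        simp only [Fin.append_left, hardDigits]
        by_cases hcb : c = b
        · subst hcb
          by_cases hca : c = r (high x)
          · have : α c = false := by
              have h2 := hr (high x)
              rw [← hca] at h2
              simpa [h2] using hb
            simp [← hca, this]
          · by_cases hcR : c ∈ R <;> simp [hca, hcR]
        · simp [hcb]
      | right c => simp
  | right c =>
    refine Or.inl fun x => hv' _ _ (hardFn_lt_hardFn_iff.2 (Or.inl ?_)).le
    rw [binVal_lt_iff]
    refine ⟨c, by simp [high], by simp [high], fun b hb => ?_⟩
    simp [high, hb.ne']

theorem hardFn_update_false_lt {R : Finset (Fin n)} {r : Cube s → Fin n} {σ : Cube s → Bool}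
    {x : Cube (n + s)} (h : σ (high x) = false) :
    hardFn R r σ (Function.update x (Fin.castAdd s (r (high x))) false) <
      hardFn R r σ (Function.update x (Fin.castAdd s (r (high x))) true) := by
  rw [hardFn_update_castAdd, hardFn_update_castAdd, binVal_append_lt_iff]
  refine Or.inr ⟨rfl, binVal_lt_iff.2 ⟨r (high x), ?_, ?_, fun b hb => ?_⟩⟩
  · simp [hardDigits, h]
  · simp [hardDigits, h]
  · simp [hardDigits, hb.ne']

theorem hardFn_update_true_lt {R : Finset (Fin n)} {r : Cube s → Fin n} {σ : Cube s → Bool}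
    {x : Cube (n + s)} (h : σ (high x) = true) :
    hardFn R r σ (Function.update x (Fin.castAdd s (r (high x))) true) <
      hardFn R r σ (Function.update x (Fin.castAdd s (r (high x))) false) := by
  rw [hardFn_update_castAdd, hardFn_update_castAdd, binVal_append_lt_iff]
  refine Or.inr ⟨rfl, binVal_lt_iff.2 ⟨r (high x), ?_, ?_, fun b hb => ?_⟩⟩
  · simp [hardDigits, h]
  · simp [hardDigits, h]
  · simp [hardDigits, hb.ne']

theorem two_pow_le_two_mul_card_of_flip {D : Finset (Cube n)} {b : Fin n}
    (h : ∀ y : Cube n, Function.update y b false ∈ D ∨ Function.update y b true ∈ D) :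
    2 ^ n ≤ 2 * D.card := by
  have hcov : (Finset.univ : Finset (Cube n)) ⊆
      D ∪ D.image fun y => Function.update y b (!y b) := by
    intro y _
    have hy : ∀ t, y b = t → Function.update y b t = y := fun t ht => by
      rw [← ht, Function.update_eq_self]
    have hflip : ∀ t, y b = !t → Function.update y b t ∈ D →
        y ∈ D.image fun y => Function.update y b (!y b) := fun t ht hD =>
      Finset.mem_image.2 ⟨_, hD, by simp [← ht]⟩
    rw [Finset.mem_union]
    rcases h y with h | h <;> cases hb : y b
    · rw [hy _ hb] at h; exact Or.inl h
    · exact Or.inr (hflip false (by simp [hb]) h)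
    · exact Or.inr (hflip true (by simp [hb]) h)
    · rw [hy _ hb] at h; exact Or.inl h
  have h1 := (Finset.card_le_card hcov).trans (Finset.card_union_le _ _)
  have h2 : (D.image fun y => Function.update y b (!y b)).card ≤ D.card := Finset.card_image_le
  simp only [Finset.card_univ, Fintype.card_fun, Fintype.card_bool, Fintype.card_fin] at h1
  omega

/-- If every choice of directions disagrees with the signs of at least a quarter of the subcubes,
the hard function is far from unate: on each such subcube, every edge in the direction of the pivot
has an endpoint where the value must be changed. -/
theorem isFarFromUnate_comp_hardFn {R : Finset (Fin n)} {r : Cube s → Fin n} {β : Cube s → Bool}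
    (hβ : ∀ dir : Fin n → Bool,
      2 ^ s ≤ 4 * (Finset.univ.filter fun i => dir (r i) ≠ β i).card)
    {v : ℕ → ℝ} (hv : StrictMonoOn v (Set.Iio (2 ^ (n + s)))) :
    IsFarFromUnate (1 / 8) (v ∘ hardFn R r β) := by
  classical
  intro g hg
  have hv' : ∀ x y, hardFn R r β x < hardFn R r β y →
      v (hardFn R r β x) < v (hardFn R r β y) :=
    fun x y h => hv (hardFn_lt _ _ _ _) (hardFn_lt _ _ _ _) h
  set dir : Fin n → Bool := fun b => !decide (∀ x : Cube (n + s),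
    Monotone fun a : Bool => g (Function.update x (Fin.castAdd s b) a)) with hdir
  set Δ := Finset.univ.filter fun x : Cube (n + s) => (v ∘ hardFn R r β) x ≠ g x with hΔ
  have hfib : ∀ i ∈ Finset.univ.filter (fun i => dir (r i) ≠ β i),
      2 ^ n ≤ 2 * (Δ.filter fun x => high x = i).card := by
    intro i hi
    have hi : dir (r i) ≠ β i := (Finset.mem_filter.1 hi).2
    set D : Finset (Cube n) := Finset.univ.filter fun y => Fin.append y i ∈ Δ with hD
    have hcard : D.card ≤ (Δ.filter fun x => high x = i).card := by
      refine Finset.card_le_card_of_injOn (fun y => Fin.append y i) ?_ ?_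
      · intro y hy
        have : Fin.append y i ∈ Δ := (Finset.mem_filter.1 hy).2
        exact Finset.mem_filter.2 ⟨this, high_append y i⟩
      · intro y _ y' _ h
        rw [← low_append y i, ← low_append y' i]
        exact congrArg low h
    refine le_trans (two_pow_le_two_mul_card_of_flip (b := r i) fun y => ?_)
      (Nat.mul_le_mul_left 2 hcard)
    have happ : ∀ t, Fin.append (Function.update y (r i) t) i =
        Function.update (Fin.append y i) (Fin.castAdd s (r i)) t := fun t => by
      rw [← append_low_high (Function.update (Fin.append y i) (Fin.castAdd s (r i)) t)]
      simp
    by_contra hcon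
    simp only [hD, hΔ, Finset.mem_filter, Finset.mem_univ, true_and, not_or, not_not, happ,
      Function.comp_apply] at hcon
    obtain ⟨e0, e1⟩ := hcon
    by_cases hmono : ∀ x : Cube (n + s),
        Monotone fun a : Bool => g (Function.update x (Fin.castAdd s (r i)) a)
    · have hd : dir (r i) = false := by simp [hdir, hmono]
      have hb : β i = true := by rw [hd] at hi; cases hb : β i <;> simp_all
      have h1 := hv' _ _ (hardFn_update_true_lt (R := R) (r := r) (σ := β)
        (x := Fin.append y i) (by simpa using hb))
      simp only [high_append, e0, e1] at h1
      exact absurd (monotone_bool_iff.1 (hmono (Fin.append y i))) (not_le.2 h1)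
    · have hanti := (hg (Fin.castAdd s (r i))).resolve_left hmono
      have hd : dir (r i) = true := by simp [hdir, hmono]
      have hb : β i = false := by rw [hd] at hi; cases hb : β i <;> simp_all
      have h1 := hv' _ _ (hardFn_update_false_lt (R := R) (r := r) (σ := β)
        (x := Fin.append y i) (by simpa using hb))
      simp only [high_append, e0, e1] at h1
      exact absurd (antitone_bool_iff.1 (hanti (Fin.append y i))) (not_le.2 h1)
  have h1 : (Finset.univ.filter fun i => dir (r i) ≠ β i).card * 2 ^ n ≤ 2 * Δ.card := by
    rw [Finset.card_eq_sum_card_fiberwise (f := high) (s := Δ) (t := Finset.univ) (by simp),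
      Finset.mul_sum, ← smul_eq_mul]
    exact (Finset.card_nsmul_le_sum _ _ _ hfib).trans
      (Finset.sum_le_sum_of_subset (Finset.filter_subset _ _))
  have h2 : 2 ^ s * 2 ^ n ≤ 8 * Δ.card := by
    have := Nat.mul_le_mul_right (2 ^ n) (hβ dir)
    rw [mul_assoc] at this
    omega
  have h3 : (2 : ℝ) ^ s * 2 ^ n ≤ 8 * Δ.card := by exact_mod_cast h2
  rw [pow_add]
  linarith

end Hard

/-! ### Finite probability and indistinguishability -/

open scoped BigOperators

section Probability

variable {Ω Ω' : Type*} [Fintype Ω] [Fintype Ω']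

open Classical in
/-- The probability of an event under the uniform distribution on a finite type. -/
noncomputable def prob (p : Ω → Prop) : ℝ := 𝔼 ω, if p ω then 1 else 0

theorem prob_mono {p q : Ω → Prop} (h : ∀ ω, p ω → q ω) : prob p ≤ prob q := by
  classical
  refine Finset.expect_le_expect fun ω _ => ?_
  by_cases hp : p ω
  · simp [hp, h ω hp]
  · simp only [hp, if_false]; positivity

theorem prob_le_one [Nonempty Ω] (p : Ω → Prop) : prob p ≤ 1 :=
  Finset.expect_le Finset.univ_nonempty fun ω _ => by split_ifs <;> simp

theorem prob_exists_le {ι : Type*} (s : Finset ι) (p : ι → Ω → Prop) :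
    prob (fun ω => ∃ i ∈ s, p i ω) ≤ ∑ i ∈ s, prob (p i) := by
  classical
  simp only [prob]
  rw [← Finset.expect_sum_comm]
  refine Finset.expect_le_expect fun ω _ => ?_
  have hnn : ∀ i ∈ s, (0 : ℝ) ≤ if p i ω then 1 else 0 := fun i _ => by positivity
  split_ifs with h
  · obtain ⟨i, hi, hp⟩ := h
    have := Finset.single_le_sum hnn hi
    simpa [hp] using this
  · exact Finset.sum_nonneg hnn

theorem prob_or_le (p q : Ω → Prop) : prob (fun ω => p ω ∨ q ω) ≤ prob p + prob q := by
  classical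
  simp only [prob]
  rw [← Finset.expect_add_distrib]
  refine Finset.expect_le_expect fun ω _ => ?_
  by_cases h1 : p ω <;> by_cases h2 : q ω <;> simp [h1, h2]

theorem prob_prod (p : Ω → Prop) (q : Ω' → Prop) :
    prob (fun ω : Ω × Ω' => p ω.1 ∧ q ω.2) = prob p * prob q := by
  classical
  simp only [prob]
  rw [Finset.expect_mul_expect, ← Finset.univ_product_univ, Finset.expect_product]
  refine Finset.expect_congr rfl fun ω _ => Finset.expect_congr rfl fun ω' _ => ?_
  by_cases h1 : p ω <;> by_cases h2 : q ω' <;> simp [h1, h2]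

theorem prob_fst [Nonempty Ω'] (p : Ω → Prop) :
    prob (fun ω : Ω × Ω' => p ω.1) = prob p := by
  have h := prob_prod p (fun _ : Ω' => True)
  simp only [and_true] at h
  have h1 : prob (fun _ : Ω' => True) = 1 :=
    (Finset.expect_congr rfl fun _ _ => if_pos trivial).trans
      (Finset.expect_const Finset.univ_nonempty 1)
  rw [h, h1, mul_one]

/-- The restriction of a uniformly random function along an injection is uniformly random. -/
theorem expect_comp_injective {ι κ X : Type*} [Fintype ι] [Fintype κ] [Fintype X]
    [DecidableEq ι] [DecidableEq κ] [Nonempty X] {e : ι → κ} (he : Function.Injective e)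
    (ψ : (ι → X) → ℝ) : 𝔼 h : κ → X, ψ (h ∘ e) = 𝔼 γ : ι → X, ψ γ := by
  classical
  let E : (κ → X) ≃ (ι → X) × ({k // ¬ k ∈ Set.range e} → X) :=
    (Equiv.piEquivPiSubtypeProd (· ∈ Set.range e) fun _ => X).trans
      (Equiv.prodCongr ((Equiv.ofInjective e he).symm.arrowCongr (Equiv.refl X)) (Equiv.refl _))
  have hE : ∀ h : κ → X, (E h).1 = h ∘ e := fun h => by
    funext i
    rfl
  rw [Finset.expect_equiv (t := Finset.univ) (g := fun p => ψ p.1) E (by simp)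
    (fun h _ => by rw [hE])]
  rw [← Finset.univ_product_univ, Finset.expect_product]
  exact Finset.expect_congr rfl fun γ _ =>
    Finset.expect_const Finset.univ_nonempty (ψ γ)

theorem prob_comp_injective {ι κ X : Type*} [Fintype ι] [Fintype κ] [Fintype X]
    [DecidableEq ι] [DecidableEq κ] [Nonempty X] {e : ι → κ} (he : Function.Injective e)
    (p : (ι → X) → Prop) : prob (fun h : κ → X => p (h ∘ e)) = prob p := by
  classical
  exact expect_comp_injective he fun γ => if p γ then 1 else 0

theorem prob_eq {ι X : Type*} [Fintype ι] [Fintype X] [DecidableEq ι] (c : ι → X) :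
    prob (fun h : ι → X => h = c) = (1 / (Fintype.card X : ℝ)) ^ Fintype.card ι := by
  classical
  have h : prob (fun h : ι → X => h = c) = 𝔼 h : ι → X, if h = c then 1 else 0 :=
    Finset.expect_congr rfl fun h _ => by
      by_cases hc : h = c <;> simp only [hc, if_true, if_false]
  rw [h, Fintype.expect_eq_sum_div_card, Finset.sum_ite_eq', if_pos (Finset.mem_univ c)]
  simp

theorem prob_forall_eq_le {ι κ X : Type*} [Fintype ι] [Fintype κ] [Fintype X]
    [DecidableEq ι] [DecidableEq κ] [Nonempty X] (e : ι → κ) {c : ι → X}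
    (hc : Function.Injective c) :
    prob (fun h : κ → X => ∀ i, h (e i) = c i) ≤ (1 / (Fintype.card X : ℝ)) ^ Fintype.card ι := by
  by_cases he : Function.Injective e
  · rw [← prob_eq c, ← prob_comp_injective he]
    exact prob_mono fun h hh => funext hh
  · refine le_trans (b := 0) (le_of_eq ?_) (by positivity)
    refine Finset.expect_eq_zero fun h _ => if_neg fun hh => he fun i j hij => hc ?_
    rw [← hh i, ← hh j, hij]

theorem prob_eq_and_eq {κ X : Type*} [Fintype κ] [Fintype X] [DecidableEq κ] [Nonempty X]
    {i j : κ} (hij : i ≠ j) (a b : X) :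
    prob (fun h : κ → X => h i = a ∧ h j = b) = 1 / (Fintype.card X : ℝ) ^ 2 := by
  have he : Function.Injective ![i, j] := by
    intro k l hkl
    fin_cases k <;> fin_cases l <;> simp_all
  have := prob_comp_injective he fun γ : Fin 2 → X => γ = ![a, b]
  rw [prob_eq, Fintype.card_fin, one_div, inv_pow, ← one_div] at this
  rw [← this]
  congr 1
  ext h
  constructor
  · rintro ⟨h1, h2⟩
    funext k
    fin_cases k <;> simp [h1, h2]
  · intro hh
    exact ⟨by simpa using congrFun hh 0, by simpa using congrFun hh 1⟩

theorem prob_apply_eq {κ X : Type*} [Fintype κ] [Fintype X] [DecidableEq κ] [Nonempty X]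
    (i : κ) (a : X) : prob (fun h : κ → X => h i = a) = 1 / (Fintype.card X : ℝ) := by
  have := prob_comp_injective (X := X) (Function.injective_of_subsingleton fun _ : Unit => i)
    fun γ => γ = fun _ => a
  rw [prob_eq, Fintype.card_unit, pow_one] at this
  rw [← this]
  congr 1
  ext h
  constructor
  · rintro rfl; rfl
  · intro hh; exact congrFun hh ()

theorem prob_not_injective_le {κ X : Type*} [Fintype κ] [Fintype X] [DecidableEq κ]
    [Nonempty X] : prob (fun h : κ → X => ¬ Function.Injective h) ≤
      (Fintype.card κ : ℝ) ^ 2 / Fintype.card X := by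
  classical
  have hX : (Fintype.card X : ℝ) ≠ 0 := by exact_mod_cast Fintype.card_ne_zero
  calc prob (fun h : κ → X => ¬ Function.Injective h)
      ≤ prob (fun h : κ → X => ∃ p ∈ (Finset.univ : Finset κ).offDiag ×ˢ (Finset.univ : Finset X),
          h p.1.1 = p.2 ∧ h p.1.2 = p.2) := by
        refine prob_mono fun h hh => ?_
        simp only [Function.Injective, not_forall] at hh
        obtain ⟨u, u', he, hne⟩ := hh
        exact ⟨((u, u'), h u), by simpa using hne, rfl, he.symm⟩
    _ ≤ ∑ p ∈ (Finset.univ : Finset κ).offDiag ×ˢ (Finset.univ : Finset X),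
          1 / (Fintype.card X : ℝ) ^ 2 := by
        refine (prob_exists_le _ _).trans (Finset.sum_le_sum fun p hp => ?_)
        simp only [Finset.mem_product, Finset.mem_offDiag] at hp
        exact (prob_eq_and_eq hp.1.2.2 _ _).le
    _ = ((Finset.univ : Finset κ).offDiag.card : ℝ) / Fintype.card X := by
        rw [Finset.sum_const, Finset.card_product, nsmul_eq_mul, Finset.card_univ]
        push_cast
        field_simp
    _ ≤ (Fintype.card κ : ℝ) ^ 2 / Fintype.card X := by
        gcongr
        rw [Finset.offDiag_card, Finset.card_univ]
        exact_mod_cast (Nat.sub_le _ _).trans (by rw [sq])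

theorem prob_subset_image_le {κ X : Type*} [Fintype κ] [Fintype X] [DecidableEq κ]
    [DecidableEq X] [Nonempty X] (T : Finset X) :
    prob (fun h : κ → X => T ⊆ Finset.univ.image h) ≤
      ((Fintype.card κ : ℝ) / Fintype.card X) ^ T.card := by
  calc prob (fun h : κ → X => T ⊆ Finset.univ.image h)
      ≤ prob (fun h : κ → X => ∃ e ∈ (Finset.univ : Finset (T → κ)), ∀ i, h (e i) = i.1) := by
        refine prob_mono fun h hh => ?_
        have : ∀ i : T, ∃ u, h u = i.1 := fun i => by simpa using hh i.2
        choose e he using this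
        exact ⟨e, Finset.mem_univ _, he⟩
    _ ≤ ∑ e ∈ (Finset.univ : Finset (T → κ)), (1 / (Fintype.card X : ℝ)) ^ Fintype.card T :=
        (prob_exists_le _ _).trans
          (Finset.sum_le_sum fun e _ => prob_forall_eq_le e Subtype.val_injective)
    _ = ((Fintype.card κ : ℝ) / Fintype.card X) ^ T.card := by
        rw [Finset.sum_const, nsmul_eq_mul, Finset.card_univ, Fintype.card_fun, Fintype.card_coe]
        push_cast
        rw [← mul_pow, mul_one_div]

end Probability

/-- The sign `-1` for `true` and `1` for `false`. -/
def signOf (b : Bool) : ℝ := if b then -1 else 1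

theorem signOf_mul_self (b : Bool) : signOf b * signOf b = 1 := by cases b <;> norm_num [signOf]

theorem expect_signOf_mul_signOf {κ : Type*} [Fintype κ] [DecidableEq κ] (i j : κ) :
    𝔼 β : κ → Bool, signOf (β i) * signOf (β j) = if i = j then 1 else 0 := by
  split_ifs with hij
  · subst hij
    simp only [signOf_mul_self]
    exact Finset.expect_const Finset.univ_nonempty _
  · -- negating `β i` changes the sign of the expectation
    have h := Finset.expect_equiv (s := Finset.univ) (t := Finset.univ)
      (f := fun β : κ → Bool => signOf (β i) * signOf (β j))
      (g := fun β : κ → Bool => -(signOf (β i) * signOf (β j)))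
      (Function.Involutive.toPerm (fun β : κ → Bool => Function.update β i (!β i))
        (fun β => by simp)) (by simp) (fun β _ => by
          change _ = -(signOf (Function.update β i (!β i) i) *
            signOf (Function.update β i (!β i) j))
          rw [Function.update_self, Function.update_of_ne (Ne.symm hij)]
          cases β i <;> cases β j <;> norm_num [signOf])
    rw [Finset.expect_neg_distrib] at h
    linarith

/-- The second moments of the sums of random signs over the classes of `t` add up to the number
of signs. -/
theorem expect_sum_sq_eq {κ U : Type*} [Fintype κ] [DecidableEq κ] [Fintype U] [DecidableEq U]
    (t : κ → U) :
    𝔼 β : κ → Bool, ∑ u, (∑ i with t i = u, signOf (β i)) ^ 2 = Fintype.card κ := by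
  rw [Finset.expect_sum_comm]
  have : ∀ u, 𝔼 β : κ → Bool, (∑ i with t i = u, signOf (β i)) ^ 2
      = ((Finset.univ.filter fun i => t i = u).card : ℝ) := by
    intro u
    simp only [sq, Finset.sum_mul_sum]
    rw [Finset.expect_sum_comm]
    simp only [Finset.expect_sum_comm, expect_signOf_mul_signOf]
    rw [Finset.card_eq_sum_ones]
    push_cast
    refine Finset.sum_congr rfl fun i hi => ?_
    rw [Finset.sum_ite_eq, if_pos hi]
  simp only [this]
  have h := Finset.card_eq_sum_card_fiberwise (f := t) (s := Finset.univ) (t := Finset.univ)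
    (by simp)
  rw [Finset.card_univ] at h
  exact_mod_cast h.symm

/-- With high probability, random signs disagree in at least a quarter of all places with every
sign pattern that is constant on the classes of `t`. -/
theorem prob_exists_few_disagreements_le {κ U : Type*} [Fintype κ] [DecidableEq κ] [Nonempty κ]
    [Fintype U] [DecidableEq U] (t : κ → U) :
    prob (fun β : κ → Bool => ∃ dir : U → Bool,
      4 * (Finset.univ.filter fun i => dir (t i) ≠ β i).card < Fintype.card κ) ≤
      4 * Fintype.card U / Fintype.card κ := by
  classical
  set m : ℝ := (Fintype.card κ : ℝ) with hm
  set M : ℝ := (Fintype.card U : ℝ) with hM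
  have hm0 : 0 < m := by rw [hm]; exact_mod_cast Fintype.card_pos
  have key : ∀ β : κ → Bool, (∃ dir : U → Bool,
      4 * (Finset.univ.filter fun i => dir (t i) ≠ β i).card < Fintype.card κ) →
      1 ≤ 4 * M / m ^ 2 * ∑ u, (∑ i with t i = u, signOf (β i)) ^ 2 := by
    rintro β ⟨dir, hdir⟩
    have h1 : ∑ i, signOf (dir (t i)) * signOf (β i) =
        m - 2 * (Finset.univ.filter fun i => dir (t i) ≠ β i).card := by
      rw [hm, ← Finset.card_univ, Finset.card_eq_sum_ones, Finset.card_eq_sum_ones]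
      push_cast
      rw [Finset.sum_filter, Finset.mul_sum, ← Finset.sum_sub_distrib]
      refine Finset.sum_congr rfl fun i _ => ?_
      cases dir (t i) <;> cases β i <;> norm_num [signOf]
    have h2 : ∑ i, signOf (dir (t i)) * signOf (β i) =
        ∑ u, signOf (dir u) * ∑ i with t i = u, signOf (β i) := by
      rw [← Finset.sum_fiberwise Finset.univ t]
      refine Finset.sum_congr rfl fun u _ => ?_
      rw [Finset.mul_sum]
      exact Finset.sum_congr rfl fun i hi => by rw [(Finset.mem_filter.1 hi).2]
    have h3 := Finset.sum_mul_sq_le_sq_mul_sq Finset.univ (fun u => signOf (dir u))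
      (fun u => ∑ i with t i = u, signOf (β i))
    rw [← h2, h1] at h3
    simp only [sq (signOf _), signOf_mul_self, Finset.sum_const, nsmul_eq_mul, mul_one,
      Finset.card_univ] at h3
    have h4 : 4 * ((Finset.univ.filter fun i => dir (t i) ≠ β i).card : ℝ) < m := by
      rw [hm]; exact_mod_cast hdir
    rw [div_mul_eq_mul_div, le_div_iff₀ (by positivity)]
    nlinarith
  calc _ ≤ 𝔼 β : κ → Bool, 4 * M / m ^ 2 * ∑ u, (∑ i with t i = u, signOf (β i)) ^ 2 := by
        refine Finset.expect_le_expect fun β _ => ?_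
        split_ifs with h
        · exact key β h
        · positivity
    _ = 4 * M / m := by
        rw [← Finset.mul_expect, expect_sum_sq_eq, ← hm]
        field_simp

section Level

variable {n s M : ℕ}

/-- The names of the subcubes in which the points of `Q` capture the coordinate `a`. -/
def capturers (Q : Finset (Cube (n + s))) (a : Fin n) : Finset (Cube s) :=
  Finset.univ.filter fun i => a ∈ capturedIn Q i

theorem sum_card_capturers_le (Q : Finset (Cube (n + s))) :
    ∑ a, (capturers Q a).card ≤ 2 * Q.card := by
  refine le_trans (le_of_eq ?_) (sum_card_capturedIn_le Q)
  have := Finset.sum_card_bipartiteAbove_eq_sum_card_bipartiteBelow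
    (s := (Finset.univ : Finset (Fin n))) (t := (Finset.univ : Finset (Cube s)))
    (fun a i => a ∈ capturedIn Q i)
  simp only [Finset.bipartiteAbove, Finset.bipartiteBelow, Finset.filter_univ_mem] at this
  simpa [capturers] using this

/-- The exceptional choices of the pivots `ω.1 (ω.2 i)`, `i : Cube s`, for the query set `Q`: the
labels `Fin M` do not receive distinct coordinates, or some two queries have their three largest
differing coordinates all among the pivot candidates, or two subcubes with the same label both
have their common pivot captured. -/
def IsRevealing (Q : Finset (Cube (n + s))) (ω : (Fin M → Fin n) × (Cube s → Fin M)) : Prop :=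
  ¬ Function.Injective ω.1 ∨
  (∃ p ∈ Q ×ˢ Q, 3 ≤ (diffSet (low p.1) (low p.2)).card ∧
    topPart 3 (diffSet (low p.1) (low p.2)) ⊆ Finset.univ.image ω.1) ∨
  ∃ p ∈ (Finset.univ : Finset (Fin n × Fin M)), ω.1 p.2 = p.1 ∧
    ∃ q ∈ (capturers Q p.1).offDiag, ω.2 q.1 = p.2 ∧ ω.2 q.2 = p.2

/-- The upper bound for the probability of `IsRevealing` that the union bound yields. -/
noncomputable def revealBound (M : ℕ) (Q : Finset (Cube (n + s))) : ℝ :=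
  (M : ℝ) ^ 2 / n + (Q.card : ℝ) ^ 2 * ((M : ℝ) / n) ^ 3 +
    ∑ a, (M : ℝ) / n * min 1 (((capturers Q a).card : ℝ) ^ 2 / (M : ℝ) ^ 2)

theorem prob_isRevealing_le [NeZero n] [NeZero M] (Q : Finset (Cube (n + s))) :
    prob (IsRevealing (M := M) Q) ≤ revealBound M Q := by
  refine (prob_or_le _ _).trans ?_
  refine (add_le_add le_rfl (prob_or_le _ _)).trans ?_
  rw [revealBound, ← add_assoc]
  gcongr ?_ + ?_ + ?_
  · rw [prob_fst (Ω' := Cube s → Fin M) fun h : Fin M → Fin n => ¬ Function.Injective h]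
    simpa using prob_not_injective_le (κ := Fin M) (X := Fin n)
  · rw [prob_fst (Ω' := Cube s → Fin M) fun h : Fin M → Fin n => ∃ p ∈ Q ×ˢ Q,
      3 ≤ (diffSet (low p.1) (low p.2)).card ∧
      topPart 3 (diffSet (low p.1) (low p.2)) ⊆ Finset.univ.image h]
    refine (prob_exists_le _ _).trans ?_
    refine (Finset.sum_le_card_nsmul _ _ (((M : ℝ) / n) ^ 3) fun p _ => ?_).trans (le_of_eq ?_)
    · by_cases h3 : 3 ≤ (diffSet (low p.1) (low p.2)).card
      · have := prob_subset_image_le (κ := Fin M) (topPart 3 (diffSet (low p.1) (low p.2)))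
        rw [card_topPart, min_eq_left h3, Fintype.card_fin, Fintype.card_fin] at this
        exact (prob_mono fun h hh => hh.2).trans this
      · refine le_trans (le_of_eq ?_) (by positivity : (0 : ℝ) ≤ _)
        exact Finset.expect_eq_zero fun h _ => if_neg fun hh => h3 hh.1
    · rw [Finset.card_product, nsmul_eq_mul]; push_cast; ring
  · refine (prob_exists_le _ _).trans ?_
    rw [Fintype.sum_prod_type]
    refine Finset.sum_le_sum fun a _ => ?_
    refine (Finset.sum_le_card_nsmul _ _
      (1 / (n : ℝ) * min 1 (((capturers Q a).card : ℝ) ^ 2 / (M : ℝ) ^ 2)) fun u _ => ?_).trans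
      (le_of_eq ?_)
    · have h1 := prob_prod (fun h : Fin M → Fin n => h u = a)
        (fun t : Cube s → Fin M => ∃ q ∈ (capturers Q a).offDiag, t q.1 = u ∧ t q.2 = u)
      rw [prob_apply_eq, Fintype.card_fin] at h1
      refine (le_of_eq h1).trans ?_
      gcongr
      refine le_min (prob_le_one _) ?_
      refine (prob_exists_le _ _).trans ?_
      refine (Finset.sum_le_card_nsmul _ _ (1 / (M : ℝ) ^ 2) fun q hq => ?_).trans ?_
      · have := prob_eq_and_eq (Finset.mem_offDiag.1 hq).2.2 u u
        rw [Fintype.card_fin] at this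
        exact this.le
      · rw [nsmul_eq_mul, mul_one_div, Finset.offDiag_card]
        gcongr
        exact_mod_cast (Nat.sub_le _ _).trans (by rw [sq])
    · rw [Finset.card_univ, Fintype.card_fin, nsmul_eq_mul]
      ring

/-- Outside the exceptional choices, the unate and the far distribution give the same expectation
to every functional of the order pattern on `Q`: it only sees the signs of subcubes whose pivot is
captured, these pivots are distinct, so both families of visible signs are uniform. -/
theorem expect_eq_of_not_isRevealing {Q : Finset (Cube (n + s))}
    {ω : (Fin M → Fin n) × (Cube s → Fin M)} (hω : ¬ IsRevealing Q ω)
    {H : (Cube (n + s) → ℕ) → ℝ}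
    (hH : ∀ f g : Cube (n + s) → ℕ, (∀ x ∈ Q, f x < 2 ^ (n + s)) → (∀ x ∈ Q, g x < 2 ^ (n + s)) →
      (∀ x ∈ Q, ∀ y ∈ Q, f x < f y ↔ g x < g y) → H f = H g) :
    𝔼 α : Fin n → Bool, H (hardFn (Finset.univ.image ω.1) (fun i => ω.1 (ω.2 i))
        fun i => α (ω.1 (ω.2 i))) =
      𝔼 β : Cube s → Bool, H (hardFn (Finset.univ.image ω.1) (fun i => ω.1 (ω.2 i)) β) := by
  classical
  obtain ⟨h, t⟩ := ω
  simp only [IsRevealing, not_or, not_not, not_exists, not_and] at hω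
  obtain ⟨hinj, hpair, hcol⟩ := hω
  set r : Cube s → Fin n := fun i => h (t i) with hr
  let I := {i : Cube s // r i ∈ capturedIn Q i}
  have hrI : Function.Injective fun i : I => r i.1 := by
    rintro ⟨i, hi⟩ ⟨j, hj⟩ hij
    by_contra hne
    have hij' : r i = r j := hij
    refine hcol (r i, t i) (Finset.mem_univ _) rfl (i, j) ?_ rfl (hinj hij').symm
    refine Finset.mem_offDiag.2 ⟨?_, ?_, fun h => hne (Subtype.ext h)⟩
    · exact Finset.mem_filter.2 ⟨Finset.mem_univ _, hi⟩
    · exact Finset.mem_filter.2 ⟨Finset.mem_univ _, by rw [hij']; exact hj⟩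
  let ψ : (I → Bool) → ℝ := fun γ => H (hardFn (Finset.univ.image h) r
    fun i => if hi : r i ∈ capturedIn Q i then γ ⟨i, hi⟩ else false)
  have hψ : ∀ σ : Cube s → Bool,
      H (hardFn (Finset.univ.image h) r σ) = ψ (σ ∘ Subtype.val) := fun σ =>
    hH _ _ (fun x _ => hardFn_lt _ _ _ _) (fun x _ => hardFn_lt _ _ _ _) fun x hx y hy =>
      hardFn_lt_iff_of_agree (fun i => by simp [hr])
        (fun x hx y hy => hpair (x, y) (Finset.mem_product.2 ⟨hx, hy⟩))
        (fun i hi => by simp [hi]) hx hy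
  calc _ = 𝔼 α : Fin n → Bool, ψ (α ∘ fun i : I => r i.1) :=
        Finset.expect_congr rfl fun α _ => hψ fun i => α (r i)
    _ = 𝔼 γ, ψ γ := expect_comp_injective hrI ψ
    _ = 𝔼 β : Cube s → Bool, ψ (β ∘ Subtype.val) :=
        (expect_comp_injective Subtype.val_injective ψ).symm
    _ = _ := Finset.expect_congr rfl fun β _ => (hψ β).symm

/-- At a single scale `M`: order-invariant functionals that accept the unate hard functions and
reject the far ones put a substantial weight on query sets that are likely to be revealing. -/
theorem one_third_le_of_distinguishes [NeZero n] [NeZero M]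
    {H : Finset (Cube (n + s)) → (Cube (n + s) → ℕ) → ℝ} {w : Finset (Cube (n + s)) → ℝ}
    (hw : ∑ Q, w Q ≤ 1) (hHw : ∀ Q f, H Q f ∈ Set.Icc 0 (w Q))
    (hH : ∀ Q, ∀ f g : Cube (n + s) → ℕ, (∀ x ∈ Q, f x < 2 ^ (n + s)) →
      (∀ x ∈ Q, g x < 2 ^ (n + s)) →
      (∀ x ∈ Q, ∀ y ∈ Q, f x < f y ↔ g x < g y) → H Q f = H Q g)
    (hyes : ∀ (R : Finset (Fin n)) (r : Cube s → Fin n), (∀ i, r i ∈ R) →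
      ∀ α : Fin n → Bool, 2 / 3 ≤ ∑ Q, H Q (hardFn R r fun i => α (r i)))
    (hno : ∀ (R : Finset (Fin n)) (r : Cube s → Fin n) (β : Cube s → Bool),
      (∀ dir : Fin n → Bool, 2 ^ s ≤ 4 * (Finset.univ.filter fun i => dir (r i) ≠ β i).card) →
      ∑ Q, H Q (hardFn R r β) ≤ 1 / 3) :
    1 / 3 ≤ 4 * (M : ℝ) / 2 ^ s + ∑ Q, w Q * revealBound M Q := by
  classical
  let Θ := (Fin M → Fin n) × (Cube s → Fin M)
  let Y : Θ → Finset (Cube (n + s)) → ℝ := fun ω Q => 𝔼 α : Fin n → Bool,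
    H Q (hardFn (Finset.univ.image ω.1) (fun i => ω.1 (ω.2 i)) fun i => α (ω.1 (ω.2 i)))
  let Z : Θ → Finset (Cube (n + s)) → ℝ := fun ω Q => 𝔼 β : Cube s → Bool,
    H Q (hardFn (Finset.univ.image ω.1) (fun i => ω.1 (ω.2 i)) β)
  have hw0 : ∀ Q, 0 ≤ w Q := fun Q => (hHw Q fun _ => 0).1.trans (hHw Q fun _ => 0).2
  have hY : 2 / 3 ≤ 𝔼 ω : Θ, ∑ Q, Y ω Q := by
    refine Finset.le_expect Finset.univ_nonempty fun ω _ => ?_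
    simp only [Y]
    rw [← Finset.expect_sum_comm]
    exact Finset.le_expect Finset.univ_nonempty fun α _ =>
      hyes (Finset.univ.image ω.1) (fun i => ω.1 (ω.2 i)) (fun i => by simp) α
  have hZ : 𝔼 ω : Θ, ∑ Q, Z ω Q ≤ 1 / 3 + 4 * (M : ℝ) / 2 ^ s := by
    refine Finset.expect_le Finset.univ_nonempty fun ω _ => ?_
    simp only [Z]
    rw [← Finset.expect_sum_comm]
    have hpr := prob_exists_few_disagreements_le ω.2
    simp only [Fintype.card_fin, Fintype.card_fun, Fintype.card_bool] at hpr
    push_cast at hpr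
    refine le_trans ?_ (add_le_add le_rfl hpr)
    rw [prob, ← Finset.expect_const (s := (Finset.univ : Finset (Cube s → Bool)))
      Finset.univ_nonempty (1 / 3 : ℝ), ← Finset.expect_add_distrib]
    refine Finset.expect_le_expect fun β _ => ?_
    split_ifs with hβ
    · have h1 : ∑ Q, H Q (hardFn (Finset.univ.image ω.1) (fun i => ω.1 (ω.2 i)) β) ≤ ∑ Q, w Q :=
        Finset.sum_le_sum fun Q _ => (hHw Q _).2
      linarith
    · rw [add_zero]
      push Not at hβ
      exact hno _ _ _ fun dir => hβ fun u => dir (ω.1 u)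
  have hYZ : ∀ ω Q, Y ω Q ≤ Z ω Q + w Q * if IsRevealing Q ω then 1 else 0 := by
    intro ω Q
    split_ifs with hω
    · have h1 : Y ω Q ≤ w Q := Finset.expect_le Finset.univ_nonempty fun α _ => (hHw Q _).2
      have h2 : 0 ≤ Z ω Q := Finset.expect_nonneg fun β _ => (hHw Q _).1
      linarith
    · rw [mul_zero, add_zero]
      exact (expect_eq_of_not_isRevealing hω (hH Q)).le
  have hsum : 𝔼 ω : Θ, ∑ Q, Y ω Q ≤
      𝔼 ω : Θ, ∑ Q, Z ω Q + ∑ Q, w Q * prob (IsRevealing (M := M) Q) := by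
    simp only [prob, Finset.mul_expect]
    rw [← Finset.expect_sum_comm, ← Finset.expect_add_distrib]
    refine Finset.expect_le_expect fun ω _ => ?_
    rw [← Finset.sum_add_distrib]
    exact Finset.sum_le_sum fun Q _ => hYZ ω Q
  have hB : ∑ Q, w Q * prob (IsRevealing (M := M) Q) ≤ ∑ Q, w Q * revealBound M Q :=
    Finset.sum_le_sum fun Q _ => mul_le_mul_of_nonneg_left (prob_isRevealing_le Q) (hw0 Q)
  linarith

end Level

/-! ### Averaging over the scales and the query bound -/

/-- The geometric series behind the logarithmic gain: the sum over all scales costs only a constant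
factor. -/
theorem sum_two_pow_mul_min_le (N K : ℕ) :
    ∑ k ∈ Finset.range K, (2 : ℝ) ^ k * min 1 ((N : ℝ) ^ 2 / ((2 : ℝ) ^ k) ^ 2) ≤ 4 * N := by
  rcases Nat.eq_zero_or_pos N with rfl | hN
  · simp
  have hN1 : (1 : ℝ) ≤ N := by exact_mod_cast hN
  -- below the peak at `2 ^ K ≈ N` the sum is dominated by the next term, beyond it the remaining
  -- tail `2 * N ^ 2 / 2 ^ K` is kept in reserve
  have key : ((2 : ℝ) ^ K ≤ 2 * N ∧
      ∑ k ∈ Finset.range K, (2 : ℝ) ^ k * min 1 ((N : ℝ) ^ 2 / ((2 : ℝ) ^ k) ^ 2) ≤ 2 ^ K) ∨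
      ∑ k ∈ Finset.range K, (2 : ℝ) ^ k * min 1 ((N : ℝ) ^ 2 / ((2 : ℝ) ^ k) ^ 2) ≤
        4 * N - 2 * (N : ℝ) ^ 2 / 2 ^ K := by
    induction K with
    | zero => refine Or.inl ⟨?_, by simp⟩; rw [pow_zero]; linarith
    | succ K ih =>
      rw [Finset.sum_range_succ, pow_succ]
      set S := ∑ k ∈ Finset.range K, (2 : ℝ) ^ k * min 1 ((N : ℝ) ^ 2 / ((2 : ℝ) ^ k) ^ 2)
      set x : ℝ := 2 ^ K
      have hx : 0 < x := by positivity
      have h1 : x * min 1 ((N : ℝ) ^ 2 / x ^ 2) ≤ x :=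
        mul_le_of_le_one_right hx.le (min_le_left _ _)
      have h2 : x * min 1 ((N : ℝ) ^ 2 / x ^ 2) ≤ (N : ℝ) ^ 2 / x := by
        refine (mul_le_mul_of_nonneg_left (min_le_right _ _) hx.le).trans (le_of_eq ?_)
        field_simp
      have h3 : 2 * (N : ℝ) ^ 2 / (x * 2) = (N : ℝ) ^ 2 / x := by field_simp
      have h4 : 2 * (N : ℝ) ^ 2 / x = 2 * ((N : ℝ) ^ 2 / x) := by ring
      rcases ih with ⟨hx2, hS⟩ | hS
      · by_cases hxN : x ≤ N
        · exact Or.inl ⟨by linarith, by linarith⟩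
        · refine Or.inr ?_
          rw [h3]
          have : x + 2 * ((N : ℝ) ^ 2 / x) ≤ 4 * N := by
            have e : x + 2 * ((N : ℝ) ^ 2 / x) = (x ^ 2 + 2 * (N : ℝ) ^ 2) / x := by field_simp
            rw [e, div_le_iff₀ hx]
            nlinarith
          linarith
      · refine Or.inr ?_
        rw [h3]
        rw [h4] at hS
        linarith
  rcases key with ⟨h1, h2⟩ | h
  · linarith
  · have : 0 ≤ 2 * (N : ℝ) ^ 2 / 2 ^ K := by positivity
    linarith

theorem sum_revealBound_le {n s : ℕ} [NeZero n] (Q : Finset (Cube (n + s))) (K : ℕ) :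
    ∑ k ∈ Finset.range K, revealBound (2 ^ k) Q ≤
      K * (((2 : ℝ) ^ K) ^ 2 / n + (Q.card : ℝ) ^ 2 * ((2 : ℝ) ^ K / n) ^ 3) +
        8 * Q.card / n := by
  simp only [revealBound]
  rw [Finset.sum_add_distrib]
  refine add_le_add ?_ ?_
  · refine (Finset.sum_le_card_nsmul (Finset.range K) _
      (((2 : ℝ) ^ K) ^ 2 / n + (Q.card : ℝ) ^ 2 * ((2 : ℝ) ^ K / n) ^ 3) fun k hk => ?_).trans
      (le_of_eq (by rw [Finset.card_range, nsmul_eq_mul]))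
    have : (2 : ℝ) ^ k ≤ 2 ^ K := pow_le_pow_right₀ one_le_two (Finset.mem_range.1 hk).le
    push_cast
    gcongr
  · rw [Finset.sum_comm]
    have h : ∀ a : Fin n, ∑ k ∈ Finset.range K, ((2 ^ k : ℕ) : ℝ) / n *
        min 1 (((capturers Q a).card : ℝ) ^ 2 / ((2 ^ k : ℕ) : ℝ) ^ 2) ≤
        4 * (capturers Q a).card / n := by
      intro a
      refine le_trans (le_of_eq ?_) (div_le_div_of_nonneg_right
        (sum_two_pow_mul_min_le (capturers Q a).card K) (Nat.cast_nonneg n))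
      rw [Finset.sum_div]
      refine Finset.sum_congr rfl fun k _ => ?_
      push_cast
      ring
    refine (Finset.sum_le_sum fun a _ => h a).trans ?_
    rw [← Finset.sum_div, ← Finset.mul_sum]
    have h2 : (∑ a, ((capturers Q a).card : ℝ)) ≤ 2 * Q.card := by
      exact_mod_cast sum_card_capturers_le Q
    exact div_le_div_of_nonneg_right (by linarith) (Nat.cast_nonneg n)

namespace NonadaptiveAlgorithm

variable {d : ℕ} {Ω : Type*} [MeasurableSpace Ω]

theorem sum_real_queries_inter (T : NonadaptiveAlgorithm d Ω) {A : Set Ω} (hA : MeasurableSet A) :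
    ∑ Q, T.μ.real ({ω | T.queries ω = Q} ∩ A) = T.μ.real A := by
  have := T.isProbabilityMeasure
  rw [← measureReal_biUnion_finset]
  · congr 1
    ext ω
    simp
  · intro Q _ Q' _ hne
    exact Set.disjoint_left.2 fun ω h h' => hne (h.1.symm.trans h'.1)
  · exact fun Q _ => (T.measurableSet_queries Q).inter hA

theorem rejectProb_eq (T : NonadaptiveAlgorithm d Ω) (f : Cube d → ℝ) :
    T.rejectProb f = 1 - T.acceptProb f := by
  have := T.isProbabilityMeasure
  rw [acceptProb, ← probReal_compl_eq_one_sub (T.measurableSet_verdict f), rejectProb]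
  congr 1
  ext ω
  simp

theorem real_queries_inter_verdict_congr (T : NonadaptiveAlgorithm d Ω) {Q : Finset (Cube d)}
    {f g : Cube d → ℝ} (h : ∀ x ∈ Q, f x = g x) :
    T.μ.real ({ω | T.queries ω = Q} ∩ {ω | T.verdict ω (fun x => f x.1) = true}) =
      T.μ.real ({ω | T.queries ω = Q} ∩ {ω | T.verdict ω (fun x => g x.1) = true}) := by
  congr 1
  ext ω
  refine and_congr_right fun hω => ?_
  have : (fun x : {x // x ∈ T.queries ω} => f x.1) = fun x => g x.1 :=
    funext fun x => h x.1 (hω ▸ x.2)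
  simp only [Set.mem_ofPred_eq, this]

/-- Every unateness tester satisfies the inequality for a single scale `M`. -/
theorem one_third_le_of_isUnatenessTester {n s : ℕ} [NeZero n] (T : NonadaptiveAlgorithm (n + s) Ω)
    (hT : T.IsUnatenessTester (1 / 8)) (M : ℕ) [NeZero M] :
    1 / 3 ≤ 4 * (M : ℝ) / 2 ^ s + ∑ Q, T.μ.real {ω | T.queries ω = Q} * revealBound M Q := by
  have := T.isProbabilityMeasure
  obtain ⟨H, hHw, hH, hHlim⟩ := exists_orderInvariant_limit (2 ^ (n + s))
    (fun Q f => T.μ.real ({ω | T.queries ω = Q} ∩ {ω | T.verdict ω (fun x => f x.1) = true}))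
    (fun Q => T.μ.real {ω | T.queries ω = Q})
    (fun Q f => ⟨measureReal_nonneg, measureReal_mono Set.inter_subset_left⟩)
    (fun Q f g h => T.real_queries_inter_verdict_congr h)
  have hacc : ∀ f : Cube (n + s) → ℝ, ∑ Q, T.μ.real ({ω | T.queries ω = Q} ∩
      {ω | T.verdict ω (fun x => f x.1) = true}) = T.acceptProb f := fun f =>
    T.sum_real_queries_inter (T.measurableSet_verdict f)
  refine one_third_le_of_distinguishes ?_ hHw hH ?_ ?_
  · have := T.sum_real_queries_inter MeasurableSet.univ
    simp only [Set.inter_univ, probReal_univ] at this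
    exact this.le
  · intro R r hr α
    refine hHlim _ (fun x => hardFn_lt _ _ _ _) (Set.Ici (2 / 3)) isClosed_Ici fun v hv => ?_
    rw [hacc]
    exact hT.1 _ (isUnate_comp_hardFn hr α hv)
  · intro R r β hβ
    refine hHlim _ (fun x => hardFn_lt _ _ _ _) (Set.Iic (1 / 3)) isClosed_Iic fun v hv => ?_
    rw [hacc, Set.mem_Iic]
    have := hT.2 _ (isFarFromUnate_comp_hardFn (R := R) hβ hv)
    rw [T.rejectProb_eq] at this
    linarith

theorem real_queries_eq_zero (T : NonadaptiveAlgorithm d Ω) {q : ℕ} (hq : T.MakesAtMost q)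
    {Q : Finset (Cube d)} (hQ : q < Q.card) : T.μ.real {ω | T.queries ω = Q} = 0 := by
  have h0 : T.μ {ω | T.queries ω = Q} = 0 := by
    refine measure_mono_null (fun ω hω => ?_) (ae_iff.1 hq)
    simp only [Set.mem_ofPred_eq] at hω ⊢
    rw [hω]
    exact not_le.2 hQ
  rw [measureReal_def, h0, ENNReal.toReal_zero]

/-- The inequality for a single scale, summed over the scales `M = 2 ^ k`, `k < K`. -/
theorem query_bound {n s : ℕ} [NeZero n] (T : NonadaptiveAlgorithm (n + s) Ω)
    (hT : T.IsUnatenessTester (1 / 8)) {q : ℕ} (hq : T.MakesAtMost q) (K : ℕ) :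
    (K : ℝ) * (1 / 3) ≤ K * (4 * 2 ^ K / 2 ^ s) +
      (K * (((2 : ℝ) ^ K) ^ 2 / n + (q : ℝ) ^ 2 * ((2 : ℝ) ^ K / n) ^ 3) + 8 * q / n) := by
  have := T.isProbabilityMeasure
  have hlevel : ∀ k ∈ Finset.range K, (1 / 3 : ℝ) ≤ 4 * 2 ^ K / 2 ^ s +
      ∑ Q, T.μ.real {ω | T.queries ω = Q} * revealBound (2 ^ k) Q := by
    intro k hk
    have h := T.one_third_le_of_isUnatenessTester hT (2 ^ k)
    have hkK : (2 : ℝ) ^ k ≤ 2 ^ K := pow_le_pow_right₀ one_le_two (Finset.mem_range.1 hk).le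
    push_cast at h
    refine h.trans ?_
    gcongr
  have hsum := Finset.sum_le_sum hlevel
  rw [Finset.sum_add_distrib, Finset.sum_const, Finset.sum_const, Finset.card_range,
    nsmul_eq_mul, nsmul_eq_mul, Finset.sum_comm] at hsum
  refine hsum.trans (add_le_add le_rfl ?_)
  set B : ℝ := K * (((2 : ℝ) ^ K) ^ 2 / n + (q : ℝ) ^ 2 * ((2 : ℝ) ^ K / n) ^ 3) + 8 * q / n
  have hw : ∑ Q, T.μ.real {ω | T.queries ω = Q} = 1 := by
    simpa using T.sum_real_queries_inter MeasurableSet.univ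
  rw [← one_mul B, ← hw, Finset.sum_mul]
  refine Finset.sum_le_sum fun Q _ => ?_
  rw [← Finset.mul_sum]
  by_cases hQ : q < Q.card
  · rw [T.real_queries_eq_zero hq hQ, zero_mul, zero_mul]
  · have hQ' : (Q.card : ℝ) ≤ q := by exact_mod_cast not_lt.1 hQ
    refine mul_le_mul_of_nonneg_left ((sum_revealBound_le Q K).trans ?_) measureReal_nonneg
    simp only [B]
    gcongr

end NonadaptiveAlgorithm

theorem sq_le_two_pow {K : ℕ} (hK : 4 ≤ K) : K ^ 2 ≤ 2 ^ K := by
  induction K, hK using Nat.le_induction with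
  | base => norm_num
  | succ K hK ih => rw [pow_succ 2 K]; nlinarith

theorem bound_contradiction {K L m n d q : ℝ} (hK : 4 ≤ K) (hL : 16 ≤ L) (hKL : K ^ 2 ≤ L)
    (hLm : L ^ 4 ≤ m) (hmd : m ≤ d) (hdn : d ≤ 2 * n) (hq0 : 0 ≤ q) (hq : q ≤ K * d / 125)
    (h : K * (1 / 3) ≤ K * (4 * L / m) + (K * (L ^ 2 / n + q ^ 2 * (L / n) ^ 3) + 8 * q / n)) :
    False := by
  have hL0 : 0 < L := by linarith
  have hL4 : 0 < L ^ 4 := by positivity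
  have hm0 : 0 < m := by linarith
  have hn0 : 0 < n := by linarith
  have hLn : L ^ 4 ≤ 2 * n := by linarith
  have h1 : 4 * L / m ≤ 1 / 1000 := by
    rw [div_le_iff₀ hm0]
    nlinarith [pow_le_pow_left₀ (by norm_num) hL 3]
  have h2 : L ^ 2 / n ≤ 1 / 100 := by
    rw [div_le_iff₀ hn0]
    nlinarith [pow_le_pow_left₀ (by norm_num) hL 2, sq_nonneg L]
  have hqn : q ≤ 2 * K * n / 125 := by nlinarith
  have h3 : q ^ 2 * (L / n) ^ 3 ≤ 1 / 1000 := by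
    have e1 : q ^ 2 ≤ (2 * K * n / 125) ^ 2 := pow_le_pow_left₀ hq0 hqn 2
    have e2 : (2 * K * n / 125) ^ 2 ≤ 4 * L * n ^ 2 / 15625 := by nlinarith [sq_nonneg n]
    calc q ^ 2 * (L / n) ^ 3 ≤ 4 * L * n ^ 2 / 15625 * (L / n) ^ 3 := by
          gcongr; exact e1.trans e2
      _ = 4 * L ^ 4 / (15625 * n) := by field_simp
      _ ≤ 1 / 1000 := by
          rw [div_le_iff₀ (by positivity)]
          linarith
  have h4 : 8 * q / n ≤ K * (16 / 125) := by
    rw [div_le_iff₀ hn0]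
    linarith
  nlinarith

theorem theorem2 :
    ∃ c : ℝ, 0 < c ∧ ∃ d₀ : ℕ, ∀ d : ℕ, d₀ ≤ d →
      ∀ (Ω : Type*) [MeasurableSpace Ω] (T : NonadaptiveAlgorithm d Ω) (q : ℕ),
        T.IsUnatenessTester (1 / 8) → T.MakesAtMost q →
          c * ((d : ℝ) * Real.log (d : ℝ)) ≤ (q : ℝ) := by
  refine ⟨1 / 1000, by norm_num, 2 ^ 16, fun d hd Ω _ T q hT hq => ?_⟩
  obtain ⟨s, hs1, hs2⟩ : ∃ s, 2 ^ s ≤ d ∧ d < 2 ^ (s + 1) :=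
    ⟨Nat.log 2 d, Nat.pow_log_le_self 2 (by omega), Nat.lt_pow_succ_log_self one_lt_two d⟩
  have hs16 : 16 ≤ s := by
    by_contra hlt
    have : 2 ^ (s + 1) ≤ 2 ^ 16 := Nat.pow_le_pow_right two_pos (by omega)
    omega
  have h2s : 2 * s ≤ d := by
    refine le_trans ?_ hs1
    obtain ⟨p, rfl⟩ : ∃ p, s = p + 1 := ⟨s - 1, by omega⟩
    have := Nat.lt_two_pow_self (n := p)
    rw [pow_succ]
    omega
  obtain ⟨n, rfl⟩ : ∃ n, d = n + s := ⟨d - s, by omega⟩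
  have : NeZero n := ⟨by omega⟩
  by_contra hlt
  rw [not_le] at hlt
  -- with `K = s / 4`, all scales are at most `2 ^ K ≤ d ^ (1 / 4)`, while `log d = O(K)`
  set K := s / 4 with hKdef
  have hK4 : 4 ≤ K := by omega
  have hlog : Real.log ((n + s : ℕ) : ℝ) ≤ 8 * K := by
    have h1 : Real.log ((n + s : ℕ) : ℝ) ≤ Real.log ((2 : ℝ) ^ (s + 1)) :=
      Real.log_le_log (by exact_mod_cast (by omega : 0 < n + s)) (by exact_mod_cast hs2.le)
    rw [Real.log_pow] at h1
    have h2 : ((s + 1 : ℕ) : ℝ) * Real.log 2 ≤ ((s + 1 : ℕ) : ℝ) :=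
      mul_le_of_le_one_right (Nat.cast_nonneg _) (Real.log_two_lt_d9.le.trans (by norm_num))
    have h3 : ((s + 1 : ℕ) : ℝ) ≤ 8 * K := by exact_mod_cast (by omega : s + 1 ≤ 8 * K)
    exact h1.trans (h2.trans h3)
  have hd0 : (0 : ℝ) ≤ ((n + s : ℕ) : ℝ) := Nat.cast_nonneg _
  refine bound_contradiction (K := K) (L := 2 ^ K) (m := 2 ^ s) (n := n) (d := ((n + s : ℕ) : ℝ))
    (q := q) (by exact_mod_cast hK4) ?_ (by exact_mod_cast sq_le_two_pow hK4) ?_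
    (by exact_mod_cast hs1) (by exact_mod_cast (by omega : n + s ≤ 2 * n)) (Nat.cast_nonneg q) ?_
    (T.query_bound hT hq K)
  · calc (16 : ℝ) = 2 ^ 4 := by norm_num
      _ ≤ 2 ^ K := pow_le_pow_right₀ one_le_two hK4
  · rw [← pow_mul]
    exact pow_le_pow_right₀ one_le_two (by omega)
  · have := mul_le_mul_of_nonneg_left hlog hd0
    linarith
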